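/- A (deterministic, leveled) $D$-way branching program $P$ on inputs $x\in D^n$ has layers $L_0,\dots,L_T$ of nodes, where $L_0$ contains only the root; each node in a layer $L_t$ with $t<T$ is labeled with an index $i\in[n]$ and has, for each $a\in D$, one outgoing edge to a node of $L_{t+1}$, which is followed if $x_i=a$; the nodes of $L_T$ are labeled with the Boolean output. Its time is $T(P)=T$ and its cumulative memory is $CM(P)=\sum_{t=0}^{T}\log_2|L_t|$. Let $ED_{n,N}:[N]^n\to\{0,1\}$ be the function that is $1$ iff all $n$ input values are distinct. **Theorem.** There is an absolute constant $C>0$ such that the following holds for every function $T:\mathbb N\to\mathbb N$ with $T(n)=o\bigl(n\sqrt{\log n/\log\log n}\bigr)$. There is a sequence $\delta(n)\to 0$ such that, for all sufficiently large $n$, every $[n^2]$-way branching program $P$ that computes $ED_{n,n^2}$ in time $\tau=T(P)\le T(n)$ satisfies $$CM(P)\ \ge\ \frac{n^2}{\max(\tau/n,\,2)^{\,C\tau^2/n^2}}\ \ge\ n^{2-\delta(n)}.$$ That is, time $T=o(n\sqrt{\log n/\log\log n})$ requires cumulative memory $n^2/(T/n)^{O(T^2/n^2)}$, which is $n^{2-o(1)}$.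 -/

import Mathlib

/-- A (deterministic, leveled) `D`-way branching program on inputs `x ∈ D^n` with Boolean output.
It has layers `0, 1, …, time`; the nodes of layer `t` are indexed by `Fin (width t)`; layer `0`
consists of the root; every node of a layer before the last one is labeled with the index of the
input coordinate that it queries and has, for every `a : D`, one outgoing edge, to the next layer.
The sinks, that is, the nodes of the last layer, are labeled with the output. -/
structure BranchingProgram (D : Type*) (n : ℕ) where
  /-- the length of the program -/
  time : ℕ
  /-- the number `|L_t|` of nodes of layer `t` -/
  width : Fin (time + 1) → ℕ
  width_zero : width 0 = 1
  /-- the coordinate queried at a node of layer `t < time` -/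
  query : ∀ t : Fin time, Fin (width t.castSucc) → Fin n
  /-- the end point of the edge labeled with a given value that leaves a given node -/
  next : ∀ t : Fin time, Fin (width t.castSucc) → D → Fin (width t.succ)
  /-- the output at the sinks -/
  sinkLabel : Fin (width (Fin.last time)) → Bool

namespace BranchingProgram

variable {D : Type*} {n : ℕ}

/-- The root, the only node of layer `0`. -/
def root (P : BranchingProgram D n) : Fin (P.width 0) :=
  ⟨0, by rw [P.width_zero]; exact Nat.one_pos⟩

/-- The node of layer `t` that the computation on input `x` visits. -/
def nodeAt (P : BranchingProgram D n) (x : Fin n → D) : ∀ t : Fin (P.time + 1), Fin (P.width t) :=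
  Fin.induction P.root (fun t v => P.next t v (x (P.query t v)))

/-- The output of the program on input `x`. -/
def output (P : BranchingProgram D n) (x : Fin n → D) : Bool :=
  P.sinkLabel (P.nodeAt x (Fin.last P.time))

/-- The program computes `f` (on every input, without error). -/
def Computes (P : BranchingProgram D n) (f : (Fin n → D) → Bool) : Prop :=
  ∀ x, P.output x = f x

/-- The cumulative memory `∑ t, log₂ |L_t|`, over all layers `t = 0, …, time`. -/
noncomputable def cumulativeMemory (P : BranchingProgram D n) : ℝ :=
  ∑ t : Fin (P.time + 1), Real.logb 2 (P.width t)

end BranchingProgram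

/-- Element Distinctness `ED_{n,N} : [N]^n → {0,1}`, which is `1` iff all values are distinct. -/
def elementDistinctness (n N : ℕ) (x : Fin n → Fin N) : Bool :=
  decide (Function.Injective x)

/-- The lower bound `n² / (τ/n)^(C τ²/n²)` for programs of time `τ` on `n` inputs, where the base
`τ/n` is read as `2` when `τ < 2 n`. -/
noncomputable def edBound (C : ℝ) (n τ : ℕ) : ℝ :=
  (n : ℝ) ^ 2 / (max ((τ : ℝ) / n) 2) ^ (C * ((τ : ℝ) ^ 2 / (n : ℝ) ^ 2))

/-! Cut time into segments of length `h` and group the distinct-valued inputs by the nodes visited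
at segment boundaries. Colour the segments at random with `K` colours and single out two colours
`a`, `b`. The coordinates read only in segments of colour `a`, and those read only in segments of
colour `b`, are the feet of an embedded rectangle: within a group of inputs with the same feet and
the same values off them, the `a`-foot of one input can be combined with the rest of another and the
program still accepts. For Element Distinctness this forces the values on the two feet to be
disjoint, so one foot uses at most half of the alphabet, and a group with feet of size `f` has
density at most `2 / 2 ^ f` (`card_mul_two_pow_le_of_rectangles`).

That count needs both feet to be recoverable from the values off either one. What is read outside
colour `b` reveals the `b`-foot, but not which coordinates read in colour `a` are read in colour `b`
too. The remedy is to predict the `a`-foot: its members are mostly the coordinates with exactly `l`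
segments of colour `a`, all others being of colour `b`. This set is visible outside colour `b`, and
the error of the prediction is a small set, recorded as side information.

The prediction is good if `l` dominates the distribution of the number of segments per coordinate,
at the scale `K = Q ^ i`. A pigeonhole over scales finds such `i` and `l` (`exists_dominantLevel`).
With time at most `k n` the expected foot size stays at least `μ = n / Q ^ (10 k²)`, where `Q` is a
power of `2 ^ κ ≥ k`; this is the source of the loss `(τ/n) ^ O(τ²/n²)`.

Injective inputs have density at least `1 / n`, so there are at least `2 ^ (μ / 4)` sequences of
boundary nodes (`two_rpow_le_boundaryStates`). Shifting the cut by each of `h ≈ μ / (64 k)` offsets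
makes every layer a boundary at most once; summing gives cumulative memory at least `h μ / 4`, about
`μ² / k`. -/

namespace BranchingProgram

/-! ### Computations compared segment by segment. -/

variable {D : Type*} {n : ℕ}

/-- The coordinate that the computation on `x` queries at step `t`. -/
def queryAt (P : BranchingProgram D n) (x : Fin n → D) (t : Fin P.time) : Fin n :=
  P.query t (P.nodeAt x t.castSucc)

theorem nodeAt_succ (P : BranchingProgram D n) (x : Fin n → D) (t : Fin P.time) :
    P.nodeAt x t.succ = P.next t (P.nodeAt x t.castSucc) (x (P.queryAt x t)) := rfl

theorem queryAt_congr (P : BranchingProgram D n) {x y : Fin n → D} {t : Fin P.time}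
    (h : P.nodeAt x t.castSucc = P.nodeAt y t.castSucc) : P.queryAt x t = P.queryAt y t := by
  unfold queryAt; rw [h]

theorem nodeAt_succ_congr (P : BranchingProgram D n) {x y : Fin n → D} {t : Fin P.time}
    (h : P.nodeAt x t.castSucc = P.nodeAt y t.castSucc)
    (hv : x (P.queryAt x t) = y (P.queryAt x t)) :
    P.nodeAt x t.succ = P.nodeAt y t.succ := by
  rw [nodeAt_succ, nodeAt_succ, ← P.queryAt_congr h, h, hv]

/-- Two computations visit the same node whenever they enter a new segment of time. -/
def SameBoundary {ι : Type*} (P : BranchingProgram D n) (seg : ℕ → ι) (x y : Fin n → D) : Prop :=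
  ∀ t : Fin P.time, seg (t + 1) ≠ seg t → P.nodeAt x t.succ = P.nodeAt y t.succ

/-- If two computations agree at the boundaries of the segments, and their inputs agree on what
both of them query in the segments of a set `S`, then they coincide in those segments. -/
theorem nodeAt_eq_of_agree {ι : Type*} (P : BranchingProgram D n) {seg : ℕ → ι} {x y : Fin n → D}
    (hb : P.SameBoundary seg x y) (S : Set ι)
    (hxy : ∀ t : Fin P.time, seg t ∈ S → P.queryAt x t = P.queryAt y t →
      x (P.queryAt x t) = y (P.queryAt x t)) (t : Fin (P.time + 1)) :
    seg t ∈ S → P.nodeAt x t = P.nodeAt y t := by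
  induction t using Fin.induction with
  | zero => intro _; rfl
  | succ t ih =>
    intro hs
    -- Inside a segment equality propagates from the previous node; on entering a segment it is
    -- supplied by `hb`, whatever happened before.
    by_cases hseg : seg (t + 1) = seg t
    · have hs' : seg t ∈ S := by
        rw [← hseg]; simpa using hs
      have h := ih (by simpa using hs')
      exact P.nodeAt_succ_congr h (hxy t hs' (P.queryAt_congr h))
    · exact hb t hseg

/-- If an input `y` agrees, segment by segment, with what one of two computations with equal
boundary nodes reads, then its computation follows these two computations segment by segment. -/
theorem nodeAt_mix {ι : Type*} (P : BranchingProgram D n) {seg : ℕ → ι} {x x' y : Fin n → D}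
    (hb : P.SameBoundary seg x x') (S : Set ι)
    (h₁ : ∀ t : Fin P.time, seg t ∈ S → x (P.queryAt x t) = y (P.queryAt x t))
    (h₂ : ∀ t : Fin P.time, seg t ∉ S → x' (P.queryAt x' t) = y (P.queryAt x' t))
    (t : Fin (P.time + 1)) :
    (seg t ∈ S → P.nodeAt x t = P.nodeAt y t) ∧ (seg t ∉ S → P.nodeAt x' t = P.nodeAt y t) := by
  induction t using Fin.induction with
  | zero => exact ⟨fun _ => rfl, fun _ => rfl⟩
  | succ t ih =>
    have hval : seg (t.castSucc : Fin (P.time + 1)) = seg t := rfl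
    have hval' : seg (t.succ : Fin (P.time + 1)) = seg (t + 1) := by simp
    rw [hval] at ih
    rw [hval']
    by_cases hS : seg t ∈ S
    · have key : P.nodeAt x t.succ = P.nodeAt y t.succ := P.nodeAt_succ_congr (ih.1 hS) (h₁ t hS)
      -- Leaving `S` means changing segment, and there `x` and `x'` are at the same node, so `y` can
      -- switch from following one to following the other.
      refine ⟨fun _ => key, fun hn => ?_⟩
      rw [← key]
      exact (hb t (fun h => hn (h ▸ hS))).symm
    · have key : P.nodeAt x' t.succ = P.nodeAt y t.succ :=
        P.nodeAt_succ_congr (ih.2 hS) (h₂ t hS)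
      refine ⟨fun hn => ?_, fun _ => key⟩
      rw [← key]
      exact hb t (fun h => hS (h ▸ hn))

/-- A program for Element Distinctness reads every coordinate of an input with distinct values. -/
theorem exists_queryAt_eq {N : ℕ} (hn : 2 ≤ n) (P : BranchingProgram (Fin N) n)
    (hP : P.Computes (elementDistinctness n N)) {x : Fin n → Fin N} (hx : Function.Injective x)
    (j : Fin n) : ∃ t, P.queryAt x t = j := by
  by_contra hj
  push Not at hj
  have : Nontrivial (Fin n) := Fin.nontrivial_iff_two_le.2 hn
  obtain ⟨i, hij⟩ := exists_ne j
  let y := Function.update x j (x i)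
  have hnode : ∀ t, P.nodeAt x t = P.nodeAt y t := by
    intro t
    induction t using Fin.induction with
    | zero => rfl
    | succ t ih =>
      refine P.nodeAt_succ_congr ih ?_
      simp [y, Function.update_of_ne (hj t)]
  have hout : P.output x = P.output y := by simp only [output, hnode]
  rw [hP x, hP y] at hout
  simp only [elementDistinctness, hx, decide_true] at hout
  have hy : Function.Injective y := by simpa using hout.symm
  exact hij (hy (by simp [y, Function.update_of_ne hij]))

end BranchingProgram

/-! ### Density of embedded rectangles. -/

/-- The inputs that agree with `x` off `F x`, over all `x` in a set on which `F` is determined by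
the values off `F`, cover every point boundedly often. If the values taken on `F x` by the inputs
of the same fibre lie in a set with at most half of the alphabet, the set is small. -/
theorem card_mul_two_pow_le_of_fibres {n N f : ℕ} (E : Finset (Fin n → Fin N))
    (F : (Fin n → Fin N) → Finset (Fin n)) (V : (Fin n → Fin N) → Finset (Fin N))
    (hF : ∀ x ∈ E, ∀ y ∈ E, (∀ j, j ∉ F x → j ∉ F y → x j = y j) → F x = F y)
    (hV : ∀ x ∈ E, ∀ y ∈ E, F x = F y → (∀ j ∉ F x, x j = y j) → ∀ j ∈ F x, y j ∈ V x)
    (hVc : ∀ x ∈ E, 2 * (V x).card ≤ N) (hf : ∀ x ∈ E, f ≤ (F x).card) :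
    (E.card : ℝ) * 2 ^ f ≤ (N : ℝ) ^ n := by
  classical
  rcases Nat.eq_zero_or_pos N with rfl | hN
  · rcases Nat.eq_zero_or_pos n with rfl | hn
    · rcases E.eq_empty_or_nonempty with rfl | ⟨x, hx⟩
      · simp
      · have : f = 0 := by simpa using (hf x hx).trans (Finset.card_le_univ _)
        subst this
        have := Finset.card_le_univ E
        simp at this
        simpa using this
    · have : E = ∅ := Finset.eq_empty_of_forall_notMem fun x _ => (x ⟨0, hn⟩).elim0
      simp [this, hn.ne']
  have hN' : (0 : ℝ) < N := by exact_mod_cast hN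
  let Q : (Fin n → Fin N) → Finset (Fin n → Fin N) := fun x =>
    Fintype.piFinset fun j => if j ∈ F x then Finset.univ else {x j}
  have hQmem : ∀ x y, y ∈ Q x ↔ ∀ j, j ∉ F x → y j = x j := by
    intro x y
    simp only [Q, Fintype.mem_piFinset]
    refine forall_congr' fun j => ?_
    split_ifs with h <;> simp [h]
  have hQcard : ∀ x, (Q x).card = N ^ (F x).card := by
    intro x
    simp only [Q, Fintype.card_piFinset]
    rw [← Finset.prod_subset (Finset.subset_univ (F x))]
    · rw [Finset.prod_congr rfl (fun j hj => by rw [if_pos hj])]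
      simp
    · intro j _ hj; simp [hj]
  -- Double counting: each `x` spreads weight `1` evenly over its subcube `Q x`.
  have hsum : (E.card : ℝ) = ∑ y, ∑ x ∈ E with y ∈ Q x, ((N : ℝ) ^ (F x).card)⁻¹ := by
    have : (E.card : ℝ) = ∑ x ∈ E, ∑ y ∈ Q x, ((N : ℝ) ^ (F x).card)⁻¹ := by
      rw [Finset.card_eq_sum_ones, Nat.cast_sum]
      refine Finset.sum_congr rfl fun x _ => ?_
      rw [Finset.sum_const, hQcard, nsmul_eq_mul]
      push_cast
      rw [mul_inv_cancel₀ (by positivity)]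
    rw [this]
    refine Finset.sum_comm' ?_
    intro x y
    simp [and_comm]
  -- By `hF`, all `x` whose subcube contains `y` share their foot and their values off it. They
  -- differ only on the foot, with values in `V x₀`, so there are at most `(N / 2) ^ |F x₀|` of
  -- them, each of weight `N ^ (-|F x₀|)`.
  have hfib : ∀ y, ∑ x ∈ E with y ∈ Q x, ((N : ℝ) ^ (F x).card)⁻¹ ≤ ((2 : ℝ) ^ f)⁻¹ := by
    intro y
    rcases (E.filter fun x => y ∈ Q x).eq_empty_or_nonempty with h0 | ⟨x₀, hx₀⟩
    · rw [h0]; simp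
    obtain ⟨hx₀E, hx₀y⟩ := Finset.mem_filter.1 hx₀
    have hsame : ∀ x ∈ E.filter (fun x => y ∈ Q x), F x₀ = F x ∧ ∀ j ∉ F x₀, x₀ j = x j := by
      intro x hx
      obtain ⟨hxE, hxy⟩ := Finset.mem_filter.1 hx
      rw [hQmem] at hx₀y hxy
      have hFF : F x₀ = F x :=
        hF x₀ hx₀E x hxE fun j h h' => (hx₀y j h).symm.trans (hxy j h')
      exact ⟨hFF, fun j h => (hx₀y j h).symm.trans (hxy j (hFF ▸ h))⟩
    have hsub : E.filter (fun x => y ∈ Q x) ⊆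
        Fintype.piFinset fun j => if j ∈ F x₀ then V x₀ else {x₀ j} := by
      intro x hx
      obtain ⟨hFF, hval⟩ := hsame x hx
      rw [Fintype.mem_piFinset]
      intro j
      split_ifs with h
      · exact hV x₀ hx₀E x (Finset.mem_filter.1 hx).1 hFF hval j h
      · simp [hval j h]
    have hcard := Finset.card_le_card hsub
    rw [Fintype.card_piFinset, ← Finset.prod_subset (Finset.subset_univ (F x₀))
      (fun j _ hj => by simp [hj]), Finset.prod_congr rfl (fun j hj => by rw [if_pos hj]),
      Finset.prod_const] at hcard
    have hb : ((V x₀).card : ℝ) ≤ N / 2 := by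
      have : ((2 * (V x₀).card : ℕ) : ℝ) ≤ N := by exact_mod_cast hVc x₀ hx₀E
      push_cast at this
      linarith
    calc ∑ x ∈ E with y ∈ Q x, ((N : ℝ) ^ (F x).card)⁻¹
        = ∑ x ∈ E with y ∈ Q x, ((N : ℝ) ^ (F x₀).card)⁻¹ :=
          Finset.sum_congr rfl fun x hx => by rw [(hsame x hx).1]
      _ = ((E.filter fun x => y ∈ Q x).card : ℝ) * ((N : ℝ) ^ (F x₀).card)⁻¹ := by
          rw [Finset.sum_const, nsmul_eq_mul]
      _ ≤ ((N : ℝ) / 2) ^ (F x₀).card * ((N : ℝ) ^ (F x₀).card)⁻¹ := by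
          gcongr
          calc ((E.filter fun x => y ∈ Q x).card : ℝ) ≤ ((V x₀).card : ℝ) ^ (F x₀).card := by
                exact_mod_cast hcard
            _ ≤ _ := by gcongr
      _ = ((2 : ℝ) ^ (F x₀).card)⁻¹ := by
          rw [div_pow]; field_simp
      _ ≤ ((2 : ℝ) ^ f)⁻¹ := by
          gcongr
          · norm_num
          · exact hf x₀ hx₀E
  have htot : (E.card : ℝ) ≤ (N : ℝ) ^ n * ((2 : ℝ) ^ f)⁻¹ := by
    rw [hsum]
    refine (Finset.sum_le_sum fun y _ => hfib y).trans ?_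
    simp
  calc (E.card : ℝ) * 2 ^ f ≤ (N : ℝ) ^ n * ((2 : ℝ) ^ f)⁻¹ * 2 ^ f := by gcongr
    _ = _ := by field_simp

/-- A family of embedded rectangles with feet `F₁ x`, `F₂ x` of size at least `f`, all of whose
points have distinct values, covers at most a `2 / 2 ^ f` fraction of all inputs, provided that the
feet are determined both by the values off `F₁` and by the values off `F₂`. -/
theorem card_mul_two_pow_le_of_rectangles {n N f : ℕ} (E : Finset (Fin n → Fin N))
    (F₁ F₂ : (Fin n → Fin N) → Finset (Fin n))
    (hmix : ∀ x ∈ E, ∀ y ∈ E, F₁ x = F₁ y → F₂ x = F₂ y →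
      (∀ j, j ∉ F₁ x → j ∉ F₂ x → x j = y j) → ∀ i ∈ F₁ x, ∀ j ∈ F₂ x, x i ≠ y j)
    (h₁ : ∀ x ∈ E, ∀ y ∈ E, (∀ j, j ∉ F₁ x → j ∉ F₁ y → x j = y j) →
      F₁ x = F₁ y ∧ F₂ x = F₂ y)
    (h₂ : ∀ x ∈ E, ∀ y ∈ E, (∀ j, j ∉ F₂ x → j ∉ F₂ y → x j = y j) →
      F₁ x = F₁ y ∧ F₂ x = F₂ y)
    (hf₁ : ∀ x ∈ E, f ≤ (F₁ x).card) (hf₂ : ∀ x ∈ E, f ≤ (F₂ x).card) :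
    (E.card : ℝ) * 2 ^ f ≤ 2 * (N : ℝ) ^ n := by
  classical
  let cls : (Fin n → Fin N) → Finset (Fin n → Fin N) := fun x =>
    E.filter fun y => F₁ x = F₁ y ∧ F₂ x = F₂ y ∧ ∀ j, j ∉ F₁ x → j ∉ F₂ x → x j = y j
  let V₁ : (Fin n → Fin N) → Finset (Fin N) := fun x => (cls x).biUnion fun y => (F₁ x).image y
  let V₂ : (Fin n → Fin N) → Finset (Fin N) := fun x => (cls x).biUnion fun y => (F₂ x).image y
  have hdisj : ∀ x, Disjoint (V₁ x) (V₂ x) := by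
    intro x
    rw [Finset.disjoint_left]
    intro v hv₁ hv₂
    simp only [V₁, V₂, cls, Finset.mem_biUnion, Finset.mem_image, Finset.mem_filter] at hv₁ hv₂
    obtain ⟨y, ⟨hyE, hy₁, hy₂, hy⟩, i, hi, rfl⟩ := hv₁
    obtain ⟨z, ⟨hzE, hz₁, hz₂, hz⟩, j, hj, hjv⟩ := hv₂
    refine hmix y hyE z hzE (hy₁.symm.trans hz₁) (hy₂.symm.trans hz₂) ?_ i (hy₁ ▸ hi) j
      (hy₂ ▸ hj) hjv.symm
    intro l hl₁ hl₂
    rw [← hy₁] at hl₁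
    rw [← hy₂] at hl₂
    exact (hy l hl₁ hl₂).symm.trans (hz l hl₁ hl₂)
  have hle : ∀ x, (V₁ x).card + (V₂ x).card ≤ N := by
    intro x
    rw [← Finset.card_union_of_disjoint (hdisj x)]
    simpa using Finset.card_le_univ (V₁ x ∪ V₂ x)
  -- Disjoint value sets cannot both exceed half of the alphabet; the two cases give the factor `2`.
  have hE : E = E.filter (fun x => 2 * (V₁ x).card ≤ N) ∪ E.filter (fun x => 2 * (V₂ x).card ≤ N) := by
    rw [← Finset.filter_or]
    refine (Finset.filter_true_of_mem fun x _ => ?_).symm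
    have := hle x
    omega
  have hE₁ := card_mul_two_pow_le_of_fibres (f := f) (E.filter fun x => 2 * (V₁ x).card ≤ N) F₁ V₁
    (fun x hx y hy h => (h₁ x (Finset.mem_filter.1 hx).1 y (Finset.mem_filter.1 hy).1 h).1)
    (fun x hx y hy hF h j hj => by
      have hx' := (Finset.mem_filter.1 hx).1
      have hy' := (Finset.mem_filter.1 hy).1
      simp only [V₁, cls, Finset.mem_biUnion, Finset.mem_image, Finset.mem_filter]
      exact ⟨y, ⟨hy', hF, (h₁ x hx' y hy' fun j hj _ => h j hj).2, fun j hj _ => h j hj⟩, j, hj, rfl⟩)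
    (fun x hx => (Finset.mem_filter.1 hx).2) (fun x hx => hf₁ x (Finset.mem_filter.1 hx).1)
  have hE₂ := card_mul_two_pow_le_of_fibres (f := f) (E.filter fun x => 2 * (V₂ x).card ≤ N) F₂ V₂
    (fun x hx y hy h => (h₂ x (Finset.mem_filter.1 hx).1 y (Finset.mem_filter.1 hy).1 h).2)
    (fun x hx y hy hF h j hj => by
      have hx' := (Finset.mem_filter.1 hx).1
      have hy' := (Finset.mem_filter.1 hy).1
      simp only [V₂, cls, Finset.mem_biUnion, Finset.mem_image, Finset.mem_filter]
      exact ⟨y, ⟨hy', (h₂ x hx' y hy' fun j hj _ => h j hj).1, hF, fun j _ hj => h j hj⟩, j, hj, rfl⟩)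
    (fun x hx => (Finset.mem_filter.1 hx).2) (fun x hx => hf₂ x (Finset.mem_filter.1 hx).1)
  have hcard : (E.card : ℝ) ≤ ((E.filter fun x => 2 * (V₁ x).card ≤ N).card : ℝ)
      + ((E.filter fun x => 2 * (V₂ x).card ≤ N).card : ℝ) := by
    conv_lhs => rw [hE]
    exact_mod_cast Finset.card_union_le _ _
  have := mul_le_mul_of_nonneg_right hcard (show (0 : ℝ) ≤ 2 ^ f by positivity)
  rw [add_mul] at this
  linarith

/-! ### Moments of random colourings. -/

section Colouring

variable {J R : Type*} [Fintype J] [DecidableEq J] [Fintype R] [DecidableEq R] {K : ℕ}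

/-- The indices `j` all of whose segments have colour `a`. -/
def monoSet (s : J → Finset R) (g : R → Fin K) (a : Fin K) : Finset J :=
  Finset.univ.filter fun j => ∀ t ∈ s j, g t = a

/-- The indices `j` exactly `l` of whose segments have colour `a` while the others have
colour `b`. -/
def levelSet (s : J → Finset R) (g : R → Fin K) (a b : Fin K) (l : ℕ) : Finset J :=
  Finset.univ.filter fun j => ((s j).filter fun t => g t = a).card = l ∧ ∀ t ∈ s j, g t = a ∨ g t = b

theorem card_colouring_eq_on (S : Finset R) (c : R → Fin K) :
    (Finset.univ.filter fun g : R → Fin K => ∀ t ∈ S, g t = c t).card * K ^ S.card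
      = K ^ Fintype.card R := by
  have h : (Finset.univ.filter fun g : R → Fin K => ∀ t ∈ S, g t = c t)
      = Fintype.piFinset fun t => if t ∈ S then {c t} else Finset.univ := by
    ext g
    simp only [Finset.mem_filter, Finset.mem_univ, true_and, Fintype.mem_piFinset]
    refine forall_congr' fun t => ?_
    split_ifs with h <;> simp [h]
  have h2 : K ^ S.card = ∏ t : R, if t ∈ S then K else 1 := by
    rw [Finset.prod_ite_mem, Finset.univ_inter, Finset.prod_const]
  rw [h, Fintype.card_piFinset, h2, ← Finset.prod_mul_distrib]
  have : ∀ t : R, (if t ∈ S then {c t} else (Finset.univ : Finset (Fin K))).card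
      * (if t ∈ S then K else 1) = K := by
    intro t; split_ifs <;> simp
  simp [this]

theorem card_colouring_eq_on_real (hK : 0 < K) (S : Finset R) (c : R → Fin K) :
    ((Finset.univ.filter fun g : R → Fin K => ∀ t ∈ S, g t = c t).card : ℝ)
      = (K : ℝ) ^ Fintype.card R / (K : ℝ) ^ S.card := by
  have hK' : (0 : ℝ) < K := by exact_mod_cast hK
  rw [eq_div_iff (by positivity)]
  exact_mod_cast card_colouring_eq_on S c

/-- The number of colourings for which `j` lies in the symmetric difference of `monoSet` and
`levelSet`. -/
theorem card_mem_symmDiff_le (hK : 0 < K) (s : J → Finset R) (a b : Fin K) (l : ℕ)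
    (j : J) :
    ((Finset.univ.filter fun g : R → Fin K =>
        j ∈ symmDiff (monoSet s g a) (levelSet s g a b l)).card : ℝ)
      ≤ if (s j).card = l then 0 else
        (1 + ((s j).card.choose l : ℝ)) * ((K : ℝ) ^ Fintype.card R / (K : ℝ) ^ (s j).card) := by
  -- With exactly `l` segments, both memberships say that all have colour `a`. Otherwise the colours
  -- on `s j` follow one of `1 + choose` prescribed patterns, each of probability `K ^ (-|s j|)`.
  split_ifs with hl
  · have : (Finset.univ.filter fun g : R → Fin K =>
        j ∈ symmDiff (monoSet s g a) (levelSet s g a b l)) = ∅ := by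
      refine Finset.filter_false_of_mem fun g _ => ?_
      simp only [Finset.mem_symmDiff, monoSet, levelSet, Finset.mem_filter, Finset.mem_univ,
        true_and]
      rintro (⟨h, h'⟩ | ⟨⟨h, h'⟩, h''⟩)
      · refine h' ⟨?_, fun t ht => Or.inl (h t ht)⟩
        rw [Finset.filter_true_of_mem h, hl]
      · refine h'' ?_
        have := Finset.eq_of_subset_of_card_le (Finset.filter_subset (fun t => g t = a) (s j))
          (by omega)
        exact Finset.filter_eq_self.1 this
    rw [this]; simp
  · have hsub : (Finset.univ.filter fun g : R → Fin K =>
        j ∈ symmDiff (monoSet s g a) (levelSet s g a b l)) ⊆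
        (Finset.univ.filter fun g : R → Fin K => ∀ t ∈ s j, g t = a) ∪
        ((s j).powersetCard l).biUnion fun S =>
          Finset.univ.filter fun g : R → Fin K => ∀ t ∈ s j, g t = if t ∈ S then a else b := by
      intro g hg
      simp only [Finset.mem_symmDiff, monoSet, levelSet, Finset.mem_filter, Finset.mem_univ,
        true_and] at hg
      simp only [Finset.mem_union, Finset.mem_filter, Finset.mem_univ, true_and,
        Finset.mem_biUnion, Finset.mem_powersetCard]
      rcases hg with ⟨h, _⟩ | ⟨⟨h, h'⟩, _⟩
      · exact Or.inl h
      · refine Or.inr ⟨_, ⟨Finset.filter_subset _ _, h⟩, fun t ht => ?_⟩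
        by_cases hta : g t = a
        · simp [ht, hta]
        · simp [(h' t ht).resolve_left hta]
    have hcard : ((Finset.univ.filter fun g : R → Fin K =>
        j ∈ symmDiff (monoSet s g a) (levelSet s g a b l)).card : ℝ) ≤
        ((Finset.univ.filter fun g : R → Fin K => ∀ t ∈ s j, g t = a).card : ℝ) +
        ∑ S ∈ (s j).powersetCard l, ((Finset.univ.filter fun g : R → Fin K =>
          ∀ t ∈ s j, g t = if t ∈ S then a else b).card : ℝ) := by
      exact_mod_cast (Finset.card_le_card hsub).trans ((Finset.card_union_le _ _).trans
        (Nat.add_le_add_left Finset.card_biUnion_le _))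
    refine hcard.trans (le_of_eq ?_)
    rw [card_colouring_eq_on_real hK (s j) fun _ => a, Finset.sum_congr rfl
      fun S _ => card_colouring_eq_on_real hK (s j) fun t => if t ∈ S then a else b,
      Finset.sum_const, Finset.card_powersetCard, nsmul_eq_mul]
    ring

/-- The first moment of the size of the symmetric difference. -/
theorem sum_card_symmDiff_le (hK : 0 < K) (s : J → Finset R) (a b : Fin K) (l : ℕ) :
    ∑ g : R → Fin K, ((symmDiff (monoSet s g a) (levelSet s g a b l)).card : ℝ)
      ≤ (K : ℝ) ^ Fintype.card R * ∑ c ∈ (Finset.range (Fintype.card R + 1)).erase l,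
        ((Finset.univ.filter fun j => (s j).card = c).card : ℝ) * (1 + (c.choose l : ℝ))
          / (K : ℝ) ^ c := by
  have h1 : ∑ g : R → Fin K, ((symmDiff (monoSet s g a) (levelSet s g a b l)).card : ℝ)
      = ∑ j, ((Finset.univ.filter fun g : R → Fin K =>
        j ∈ symmDiff (monoSet s g a) (levelSet s g a b l)).card : ℝ) := by
    have := Finset.sum_card_bipartiteAbove_eq_sum_card_bipartiteBelow
      (s := (Finset.univ : Finset (R → Fin K))) (t := (Finset.univ : Finset J))
      (fun g j => j ∈ symmDiff (monoSet s g a) (levelSet s g a b l))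
    simp only [Finset.bipartiteAbove, Finset.bipartiteBelow, Finset.filter_univ_mem] at this
    exact_mod_cast this
  rw [h1]
  refine (Finset.sum_le_sum fun j _ => card_mem_symmDiff_le hK s a b l j).trans ?_
  rw [← Finset.sum_fiberwise_of_maps_to (s := Finset.univ)
    (t := Finset.range (Fintype.card R + 1)) (g := fun j => (s j).card)
    (fun j _ => by
      have := Finset.card_le_univ (s j)
      simp only [Finset.mem_range]; omega), Finset.mul_sum]
  rw [← Finset.sum_subset (Finset.erase_subset l (Finset.range (Fintype.card R + 1)))]
  · refine le_of_eq (Finset.sum_congr rfl fun c hc => ?_)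
    rw [Finset.sum_congr rfl (g := fun _ => (1 + (c.choose l : ℝ))
      * ((K : ℝ) ^ Fintype.card R / (K : ℝ) ^ c))]
    · rw [Finset.sum_const, nsmul_eq_mul]; ring
    · intro j hj
      rw [Finset.mem_filter] at hj
      rw [hj.2, if_neg (Finset.ne_of_mem_erase hc)]
  · intro c hc hcl
    have : c = l := by
      by_contra h
      exact hcl (Finset.mem_erase.2 ⟨h, hc⟩)
    subst this
    refine Finset.sum_eq_zero fun j hj => ?_
    rw [if_pos (Finset.mem_filter.1 hj).2]

/-- The Chebyshev inequality for the number of indices with `l` segments, all of colour `a`. -/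
theorem card_small_monoSet_mul_le (hK : 0 < K) (s : J → Finset R) (a : Fin K) (l H : ℕ)
    (hH : ∀ t, (Finset.univ.filter fun j => t ∈ s j).card ≤ H) (m : ℝ)
    (hm : m = ((Finset.univ.filter fun j => (s j).card = l).card : ℝ) / (K : ℝ) ^ l)
    (hm0 : 0 < m) :
    ((Finset.univ.filter fun g : R → Fin K => ((monoSet s g a).card : ℝ) < m / 2).card : ℝ) * m
      ≤ 4 * l * H * (K : ℝ) ^ Fintype.card R := by
  have hK' : (0 : ℝ) < K := by exact_mod_cast hK
  set A := Finset.univ.filter fun j => (s j).card = l with hA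
  set Y : (R → Fin K) → ℝ := fun g => ((A.filter fun j => ∀ t ∈ s j, g t = a).card : ℝ) with hY
  set W : ℝ := (K : ℝ) ^ Fintype.card R with hW
  have hWpos : 0 < W := by positivity
  have hYle : ∀ g, Y g ≤ ((monoSet s g a).card : ℝ) := by
    intro g
    simp only [hY, monoSet]
    exact_mod_cast Finset.card_le_card (Finset.filter_subset_filter _ (Finset.subset_univ _))
  have hYsum : ∀ g, Y g = ∑ j ∈ A, if ∀ t ∈ s j, g t = a then (1 : ℝ) else 0 := by
    intro g; simp [hY]
  have hAl : ∀ j ∈ A, (s j).card = l := fun j hj => (Finset.mem_filter.1 hj).2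
  have hone : ∑ g, Y g = W * m := by
    simp only [hYsum]
    rw [Finset.sum_comm]
    have : ∀ j ∈ A, ∑ g : R → Fin K, (if ∀ t ∈ s j, g t = a then (1 : ℝ) else 0)
        = W / (K : ℝ) ^ l := by
      intro j hj
      rw [Finset.sum_boole, card_colouring_eq_on_real hK (s j) fun _ => a, hAl j hj]
    rw [Finset.sum_congr rfl this, Finset.sum_const, nsmul_eq_mul, hm]
    ring
  have htwo : ∑ g, Y g ^ 2 ≤ W * m ^ 2 + W * (m * (l * H)) := by
    have hexp : ∑ g, Y g ^ 2 = ∑ i ∈ A, ∑ j ∈ A,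
        ((Finset.univ.filter fun g : R → Fin K => ∀ t ∈ s i ∪ s j, g t = a).card : ℝ) := by
      simp only [hYsum, sq, Finset.sum_mul_sum]
      rw [Finset.sum_comm]
      refine Finset.sum_congr rfl fun i _ => ?_
      rw [Finset.sum_comm]
      refine Finset.sum_congr rfl fun j _ => ?_
      rw [← Finset.sum_boole]
      refine Finset.sum_congr rfl fun g _ => ?_
      simp only [Finset.mem_union, or_imp, forall_and]
      split_ifs <;> simp_all
    rw [hexp]
    -- Disjoint segment sets are coloured independently and contribute to the squared mean; a
    -- meeting pair costs at most the probability of one event. Each `i` meets at most `l * H`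
    -- indices, itself included.
    have hterm : ∀ i ∈ A, ∀ j ∈ A,
        ((Finset.univ.filter fun g : R → Fin K => ∀ t ∈ s i ∪ s j, g t = a).card : ℝ)
          ≤ W / (K : ℝ) ^ l * (1 / (K : ℝ) ^ l)
            + W / (K : ℝ) ^ l * (if ¬ Disjoint (s i) (s j) then 1 else 0) := by
      intro i hi j hj
      by_cases hd : Disjoint (s i) (s j)
      · rw [card_colouring_eq_on_real hK (s i ∪ s j) fun _ => a, Finset.card_union_of_disjoint hd,
          hAl i hi, hAl j hj]
        simp only [hd, not_true, if_false, mul_zero, add_zero]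
        rw [pow_add]
        apply le_of_eq
        rw [← hW]
        field_simp
      · have : ((Finset.univ.filter fun g : R → Fin K => ∀ t ∈ s i ∪ s j, g t = a).card : ℝ)
            ≤ ((Finset.univ.filter fun g : R → Fin K => ∀ t ∈ s i, g t = a).card : ℝ) := by
          exact_mod_cast Finset.card_le_card fun g hg => by
            simp only [Finset.mem_filter, Finset.mem_univ, true_and] at hg ⊢
            exact fun t ht => hg t (Finset.mem_union_left _ ht)
        rw [card_colouring_eq_on_real hK (s i) fun _ => a, hAl i hi] at this
        simp only [hd, not_false_eq_true, if_true, mul_one]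
        have : 0 ≤ W / (K : ℝ) ^ l * (1 / (K : ℝ) ^ l) := by positivity
        linarith
    have hdeg : ∀ i ∈ A, ∑ j ∈ A, (if ¬ Disjoint (s i) (s j) then (1 : ℝ) else 0) ≤ l * H := by
      intro i hi
      rw [Finset.sum_boole]
      have hsub : (A.filter fun j => ¬ Disjoint (s i) (s j)) ⊆
          (s i).biUnion fun t => Finset.univ.filter fun j => t ∈ s j := by
        intro j hj
        obtain ⟨t, ht, ht'⟩ := Finset.not_disjoint_iff.1 (Finset.mem_filter.1 hj).2
        simp only [Finset.mem_biUnion, Finset.mem_filter, Finset.mem_univ, true_and]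
        exact ⟨t, ht, ht'⟩
      have := (Finset.card_le_card hsub).trans
        (Finset.card_biUnion_le_card_mul _ _ H fun t _ => hH t)
      rw [hAl i hi] at this
      exact_mod_cast this
    calc _ ≤ ∑ i ∈ A, ∑ j ∈ A, (W / (K : ℝ) ^ l * (1 / (K : ℝ) ^ l)
            + W / (K : ℝ) ^ l * (if ¬ Disjoint (s i) (s j) then 1 else 0)) :=
          Finset.sum_le_sum fun i hi => Finset.sum_le_sum fun j hj => hterm i hi j hj
      _ ≤ ∑ i ∈ A, (A.card * (W / (K : ℝ) ^ l * (1 / (K : ℝ) ^ l))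
            + W / (K : ℝ) ^ l * (l * H)) := by
          refine Finset.sum_le_sum fun i hi => ?_
          rw [Finset.sum_add_distrib, Finset.sum_const, nsmul_eq_mul, ← Finset.mul_sum]
          gcongr
          exact hdeg i hi
      _ = W * m ^ 2 + W * (m * (l * H)) := by
          rw [Finset.sum_const, nsmul_eq_mul, hm]
          field_simp
  have hvar : ∑ g, (Y g - m) ^ 2 ≤ W * (m * (l * H)) := by
    have hc : ∑ g : R → Fin K, (m ^ 2 : ℝ) = W * m ^ 2 := by
      simp [hW]
    have : ∑ g, (Y g - m) ^ 2 = ∑ g, Y g ^ 2 - 2 * m * ∑ g, Y g + ∑ g : R → Fin K, m ^ 2 := by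
      rw [Finset.mul_sum, ← Finset.sum_sub_distrib, ← Finset.sum_add_distrib]
      refine Finset.sum_congr rfl fun g _ => by ring
    rw [this, hone, hc]
    nlinarith [htwo]
  set B := Finset.univ.filter fun g : R → Fin K => ((monoSet s g a).card : ℝ) < m / 2 with hB
  have hlow : (B.card : ℝ) * (m ^ 2 / 4) ≤ ∑ g, (Y g - m) ^ 2 := by
    calc (B.card : ℝ) * (m ^ 2 / 4) = ∑ g ∈ B, m ^ 2 / 4 := by
          rw [Finset.sum_const, nsmul_eq_mul]
      _ ≤ ∑ g ∈ B, (Y g - m) ^ 2 := by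
          refine Finset.sum_le_sum fun g hg => ?_
          have h1 : Y g < m / 2 := (hYle g).trans_lt (Finset.mem_filter.1 hg).2
          nlinarith
      _ ≤ _ := Finset.sum_le_sum_of_subset_of_nonneg (Finset.subset_univ _)
          fun g _ _ => sq_nonneg _
  have h := hlow.trans hvar
  have h' : m * (B.card * m) ≤ m * (4 * l * H * W) := by nlinarith
  exact le_of_mul_le_mul_left h' hm0

end Colouring

/-! ### Choice of the scale and of the dominant level. -/

/-- At scale `Q ^ i`, the level `l` of the distribution `c` outweighs all the others by powers
of `Q`. -/
structure DominantLevel (c : ℕ → ℕ) (Q i l : ℕ) : Prop where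
  above : ∀ d, c (l + d) ≤ Q ^ ((i - 1) * d) * c l
  below : ∀ d ≤ l, c (l - d) * Q ^ ((i + 1) * d) ≤ c l

/-- For each scale `i`, let `u i` maximize `c a / Q ^ (i a)`. Larger scales favour smaller levels,
so `u` is nonincreasing with values in `[1, L]` and must agree at two consecutive odd scales. At the
even scale between them, maximality at `i - 1` controls the levels above and maximality at `i + 1`
those below, each with a spare factor `Q` per step. -/
theorem exists_dominantLevel {c : ℕ → ℕ} {Q n B L l₀ : ℕ} (hc0 : c 0 = 0) (hcn : ∀ l, c l ≤ n)
    (hl₀ : 1 ≤ l₀) (hl₀L : l₀ ≤ L) (hB : n ≤ B * c l₀) (hBQ : B ≤ Q) (hQ : 2 ≤ Q) (hn : 0 < n) :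
    ∃ i l, 1 ≤ i ∧ i ≤ 2 * L ∧ 1 ≤ l ∧ l ≤ L ∧ DominantLevel c Q i l ∧
      (c l₀ : ℝ) / (Q : ℝ) ^ ((2 * L + 1) * L) ≤ (c l : ℝ) / ((Q : ℝ) ^ i) ^ l := by
  have hQ0 : (0 : ℝ) < Q := by exact_mod_cast (by omega : 0 < Q)
  have hQ1 : (1 : ℝ) < Q := by exact_mod_cast (by omega : 1 < Q)
  have hcl₀ : 0 < c l₀ := by
    rcases Nat.eq_zero_or_pos (c l₀) with h | h
    · rw [h] at hB; omega
    · exact h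
  have hmax : ∀ i, 1 ≤ i → ∃ l, (1 ≤ l ∧ l ≤ L) ∧
      ∀ a, (c a : ℝ) / (Q : ℝ) ^ (i * a) ≤ (c l : ℝ) / (Q : ℝ) ^ (i * l) := by
    intro i hi
    obtain ⟨l, hl, hlmax⟩ := Finset.exists_max_image (Finset.Icc 1 L)
      (fun a => (c a : ℝ) / (Q : ℝ) ^ (i * a)) ⟨l₀, Finset.mem_Icc.2 ⟨hl₀, hl₀L⟩⟩
    refine ⟨l, Finset.mem_Icc.1 hl, fun a => ?_⟩
    by_cases ha0 : a = 0
    · subst ha0; rw [hc0]; simp; positivity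
    by_cases haL : a ≤ L
    · exact hlmax a (Finset.mem_Icc.2 ⟨by omega, haL⟩)
    -- Levels beyond `L` cannot win: `l₀` is popular, so they gain at most a factor `B ≤ Q` in count
    -- and lose at least `Q ^ i` in weight.
    · refine le_trans ?_ (hlmax l₀ (Finset.mem_Icc.2 ⟨hl₀, hl₀L⟩))
      rw [div_le_div_iff₀ (by positivity) (by positivity)]
      have h1 : c a ≤ Q * c l₀ := (hcn a).trans (hB.trans (Nat.mul_le_mul_right _ hBQ))
      have h2 : Q ^ (i * l₀ + 1) ≤ Q ^ (i * a) := by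
        refine Nat.pow_le_pow_right (by omega) ?_
        have : i * (l₀ + 1) ≤ i * a := Nat.mul_le_mul_left _ (by omega)
        rw [mul_add, mul_one] at this
        omega
      have h3 : c a * Q ^ (i * l₀) ≤ c l₀ * Q ^ (i * a) :=
        calc c a * Q ^ (i * l₀) ≤ Q * c l₀ * Q ^ (i * l₀) := Nat.mul_le_mul_right _ h1
          _ = c l₀ * Q ^ (i * l₀ + 1) := by ring
          _ ≤ _ := Nat.mul_le_mul_left _ h2
      exact_mod_cast h3
  choose! u hu humax using hmax
  have hcu : ∀ i, 1 ≤ i → (0 : ℝ) < c (u i) := by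
    intro i hi
    have h1 : (0 : ℝ) < (c l₀ : ℝ) / (Q : ℝ) ^ (i * l₀) := by positivity
    have h2 := h1.trans_le (humax i hi l₀)
    by_contra h
    have : (c (u i) : ℝ) = 0 := le_antisymm (not_lt.1 h) (by positivity)
    rw [this] at h2
    simp at h2
  have hanti : ∀ i i', 1 ≤ i → i < i' → u i' ≤ u i := by
    intro i i' hi hii
    have hi' : 1 ≤ i' := by omega
    by_contra hlt
    -- Multiplying the two maximality inequalities cancels the counts and leaves `(i' - i) * (u i' -
    -- u i) ≤ 0` in the exponents.
    push Not at hlt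
    have h1 := humax i hi (u i')
    have h2 := humax i' hi' (u i)
    rw [div_le_div_iff₀ (by positivity) (by positivity)] at h1 h2
    have hc1 := hcu i hi
    have hc2 := hcu i' hi'
    have h3 : (Q : ℝ) ^ (i * u i + i' * u i') ≤ (Q : ℝ) ^ (i * u i' + i' * u i) := by
      have h4 := mul_le_mul h1 h2 (by positivity) (by positivity)
      have h5 : ((c (u i) : ℝ) * c (u i')) * (Q : ℝ) ^ (i * u i + i' * u i')
          ≤ ((c (u i) : ℝ) * c (u i')) * (Q : ℝ) ^ (i * u i' + i' * u i) := by
        rw [pow_add, pow_add]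
        nlinarith [h4]
      exact le_of_mul_le_mul_left h5 (by positivity)
    have h4 := (pow_le_pow_iff_right₀ hQ1).1 h3
    obtain ⟨p, rfl⟩ := Nat.exists_eq_add_of_lt hii
    obtain ⟨q, hq⟩ := Nat.exists_eq_add_of_lt hlt
    rw [hq] at h4
    nlinarith
  have hex : ∃ j < L, u (2 * j + 1) = u (2 * j + 3) := by
    by_contra hne
    push Not at hne
    have hstep : ∀ j ≤ L, u (2 * j + 1) + j ≤ L := by
      intro j
      induction j with
      | zero => intro _; exact (hu 1 le_rfl).2
      | succ j ih =>
        intro hj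
        have h1 := ih (by omega)
        have h2 := hne j (by omega)
        have h3 := hanti (2 * j + 1) (2 * j + 3) (by omega) (by omega)
        have h4 : 2 * (j + 1) + 1 = 2 * j + 3 := by ring
        rw [h4]
        omega
    have h1 := hstep L le_rfl
    have h2 := (hu (2 * L + 1) (by omega)).1
    omega
  obtain ⟨j, hj, hjeq⟩ := hex
  set l := u (2 * j + 1) with hl
  have hlo := humax (2 * j + 1) (by omega)
  have hhi := humax (2 * j + 3) (by omega)
  rw [← hl] at hlo
  rw [← hjeq] at hhi
  obtain ⟨hl1, hlL⟩ := hu (2 * j + 1) (by omega)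
  refine ⟨2 * j + 2, l, by omega, by omega, hl1, hlL, ⟨fun d => ?_, fun d hd => ?_⟩, ?_⟩
  · have h := hlo (l + d)
    rw [div_le_div_iff₀ (by positivity) (by positivity), mul_add, pow_add] at h
    have h' : (Q : ℝ) ^ ((2 * j + 1) * l) * c (l + d)
        ≤ (Q : ℝ) ^ ((2 * j + 1) * l) * ((Q : ℝ) ^ ((2 * j + 1) * d) * c l) := by nlinarith
    have h'' := le_of_mul_le_mul_left h' (by positivity)
    have he : 2 * j + 2 - 1 = 2 * j + 1 := by omega
    rw [he]
    exact_mod_cast h''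
  · have h := hhi (l - d)
    obtain ⟨p, hp⟩ := Nat.exists_eq_add_of_le hd
    have hp' : l - d = p := by omega
    rw [hp'] at h ⊢
    rw [div_le_div_iff₀ (by positivity) (by positivity)] at h
    have he : (2 * j + 3) * l = (2 * j + 3) * p + (2 * j + 2 + 1) * d := by rw [hp]; ring
    rw [he, pow_add] at h
    have h' : (Q : ℝ) ^ ((2 * j + 3) * p) * (c p * (Q : ℝ) ^ ((2 * j + 2 + 1) * d))
        ≤ (Q : ℝ) ^ ((2 * j + 3) * p) * c l := by nlinarith
    exact_mod_cast le_of_mul_le_mul_left h' (by positivity)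
  · calc (c l₀ : ℝ) / (Q : ℝ) ^ ((2 * L + 1) * L) ≤ (c l₀ : ℝ) / (Q : ℝ) ^ ((2 * j + 3) * l₀) := by
          refine div_le_div_of_nonneg_left (by positivity) (by positivity) ?_
          exact pow_le_pow_right₀ hQ1.le (Nat.mul_le_mul (by omega) hl₀L)
      _ ≤ (c l : ℝ) / (Q : ℝ) ^ ((2 * j + 3) * l) := hhi l₀
      _ ≤ (c l : ℝ) / ((Q : ℝ) ^ (2 * j + 2)) ^ l := by
          rw [← pow_mul]
          refine div_le_div_of_nonneg_left (by positivity) (by positivity) ?_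
          exact pow_le_pow_right₀ hQ1.le (Nat.mul_le_mul_right _ (by omega))

/-- If the average of a positive function is at most `k`, then one of its values up to `2 k` is
taken on a `1 / (4 k)` fraction of its domain. -/
theorem exists_popular_level {J : Type*} [Fintype J] (d : J → ℕ) {k : ℕ} (hk : 0 < k)
    (hd : ∀ j, 1 ≤ d j) (hsum : ∑ j, d j ≤ k * Fintype.card J) (hJ : 0 < Fintype.card J) :
    ∃ l, 1 ≤ l ∧ l ≤ 2 * k ∧
      Fintype.card J ≤ 4 * k * (Finset.univ.filter fun j => d j = l).card := by
  classical
  by_contra hne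
  push Not at hne
  set n := Fintype.card J
  have h1 : (Finset.univ.filter fun j => d j ≤ 2 * k).card
      = ∑ l ∈ Finset.Icc 1 (2 * k), (Finset.univ.filter fun j => d j = l).card := by
    rw [Finset.card_eq_sum_card_fiberwise (f := d) (t := Finset.Icc 1 (2 * k))]
    · refine Finset.sum_congr rfl fun l hl => ?_
      rw [Finset.filter_filter]
      congr 1
      ext j
      have := (Finset.mem_Icc.1 hl).2
      simp only [Finset.mem_filter, Finset.mem_univ, true_and]
      omega
    · intro j hj
      simp only [Finset.coe_filter, Finset.mem_univ, true_and, Set.mem_ofPred_eq] at hj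
      simp [hd j, hj]
  -- If no level were popular, fewer than half of the indices would have value at most `2 k`;
  -- Markov's inequality (`h3`) says that at most half lie above.
  have h2 : 4 * k * (Finset.univ.filter fun j => d j ≤ 2 * k).card < 2 * k * n := by
    rw [h1, Finset.mul_sum]
    calc ∑ l ∈ Finset.Icc 1 (2 * k), 4 * k * (Finset.univ.filter fun j => d j = l).card
        < ∑ _l ∈ Finset.Icc 1 (2 * k), n :=
          Finset.sum_lt_sum_of_nonempty ⟨1, Finset.mem_Icc.2 ⟨le_rfl, by omega⟩⟩
            fun l hl => hne l (Finset.mem_Icc.1 hl).1 (Finset.mem_Icc.1 hl).2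
      _ = 2 * k * n := by simp
  have h3 : (Finset.univ.filter fun j => ¬ d j ≤ 2 * k).card * (2 * k + 1) ≤ k * n := by
    refine le_trans ?_ hsum
    rw [← smul_eq_mul, ← Finset.sum_const]
    calc ∑ _j ∈ Finset.univ.filter (fun j => ¬ d j ≤ 2 * k), (2 * k + 1)
        ≤ ∑ j ∈ Finset.univ.filter (fun j => ¬ d j ≤ 2 * k), d j :=
          Finset.sum_le_sum fun j hj => by
            have := (Finset.mem_filter.1 hj).2
            omega
      _ ≤ ∑ j, d j := Finset.sum_le_sum_of_subset (Finset.subset_univ _)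
  have h4 := Finset.card_filter_add_card_filter_not (s := (Finset.univ : Finset J))
    (fun j => d j ≤ 2 * k)
  rw [Finset.card_univ] at h4
  change _ = n at h4
  have h5 : k * (2 * (Finset.univ.filter fun j => d j ≤ 2 * k).card) < k * n := by linarith
  have h6 := lt_of_mul_lt_mul_left h5 (Nat.zero_le _)
  have h7 : k * (2 * (Finset.univ.filter fun j => ¬ d j ≤ 2 * k).card) ≤ k * n := by nlinarith
  have h8 := le_of_mul_le_mul_left h7 hk
  omega

theorem choose_add_le_pow (l d : ℕ) : (l + d).choose l ≤ (l + 1) ^ d := by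
  induction d with
  | zero => simp
  | succ d ih =>
    have h := Nat.add_one_mul_choose_eq (l + d) d
    have e1 : (l + (d + 1)).choose l = (l + d + 1).choose (d + 1) := by
      rw [← add_assoc]; exact Nat.choose_symm_of_eq_add (by ring)
    have e2 : (l + d).choose l = (l + d).choose d := Nat.choose_symm_add
    rw [e2] at ih
    rw [e1]
    have : (d + 1) * (l + d + 1).choose (d + 1) ≤ (d + 1) * (l + 1) ^ (d + 1) :=
      calc (d + 1) * (l + d + 1).choose (d + 1) = (l + d + 1) * (l + d).choose d := by linarith
        _ ≤ ((d + 1) * (l + 1)) * (l + 1) ^ d := Nat.mul_le_mul (by nlinarith) ih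
        _ = _ := by ring
    exact le_of_mul_le_mul_left this (by omega)

theorem geom_sum_le_two {ρ : ℝ} (h0 : 0 ≤ ρ) (h : ρ ≤ 1 / 2) (M : ℕ) :
    ∑ d ∈ Finset.range M, ρ ^ (d + 1) ≤ 2 * ρ := by
  have h1 : ∑ d ∈ Finset.range M, ρ ^ d ≤ 2 := by
    refine ((summable_geometric_of_lt_one h0 (by linarith)).sum_le_tsum _
      fun _ _ => by positivity).trans ?_
    rw [tsum_geometric_of_lt_one h0 (by linarith)]
    rw [inv_le_comm₀ (by linarith) (by norm_num)]
    linarith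
  simp only [pow_succ]
  rw [← Finset.sum_mul]
  exact mul_le_mul_of_nonneg_right h1 h0

/-- Both tails are geometric of ratio `ρ = (l + 1) / Q`. Below `l` the binomial vanishes and `below`
gives `Q⁻¹` per step; above, `above` gives `Q⁻¹` per step against a binomial growth of at most `l +
1`. -/
theorem DominantLevel.sum_le {c : ℕ → ℕ} {Q i l : ℕ} (h : DominantLevel c Q i l) (hi : 1 ≤ i)
    (hQ : 2 * (l + 1) ≤ Q) (M : ℕ) :
    ∑ a ∈ (Finset.range M).erase l, (c a : ℝ) * (1 + (a.choose l : ℝ)) / (((Q ^ i : ℕ) : ℝ)) ^ a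
      ≤ 8 * ((l + 1 : ℝ) / Q) * ((c l : ℝ) / (((Q ^ i : ℕ) : ℝ)) ^ l) := by
  have hQ0 : (0 : ℝ) < Q := by exact_mod_cast (by omega : 0 < Q)
  set ρ : ℝ := (l + 1 : ℝ) / Q with hρ
  have hρ0 : 0 ≤ ρ := by positivity
  have hρ2 : ρ ≤ 1 / 2 := by
    rw [hρ, div_le_iff₀ hQ0]
    have : ((2 * (l + 1) : ℕ) : ℝ) ≤ Q := by exact_mod_cast hQ
    push_cast at this
    linarith
  push_cast
  set m : ℝ := (c l : ℝ) / ((Q : ℝ) ^ i) ^ l with hm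
  have hm0 : 0 ≤ m := by positivity
  have hQρ : (1 : ℝ) / Q ≤ ρ := by
    rw [hρ]; gcongr; linarith [show (0 : ℝ) ≤ l by positivity]
  have hlow : ∀ d < l, (c (l - 1 - d) : ℝ) * (1 + ((l - 1 - d).choose l : ℝ))
      / ((Q : ℝ) ^ i) ^ (l - 1 - d) ≤ 2 * m * ρ ^ (d + 1) := by
    intro d hd
    have hch : (l - 1 - d).choose l = 0 := Nat.choose_eq_zero_of_lt (by omega)
    rw [hch]
    have hb := h.below (d + 1) (by omega)
    have he : l - (d + 1) = l - 1 - d := by omega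
    rw [he] at hb
    set p := l - 1 - d with hp
    have hl : l = p + (d + 1) := by omega
    have hb' : (c p : ℝ) * (Q : ℝ) ^ ((i + 1) * (d + 1)) ≤ c l := by exact_mod_cast hb
    have h1 : (c p : ℝ) / ((Q : ℝ) ^ i) ^ p ≤ m * (1 / Q) ^ (d + 1) := by
      rw [hm, div_pow, one_pow, div_mul_div_comm, mul_one,
        div_le_div_iff₀ (by positivity) (by positivity)]
      have e : ((Q : ℝ) ^ i) ^ l * (Q : ℝ) ^ (d + 1)
          = ((Q : ℝ) ^ i) ^ p * (Q : ℝ) ^ ((i + 1) * (d + 1)) := by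
        rw [← pow_mul, ← pow_mul, ← pow_add, ← pow_add]
        congr 1
        rw [hl]; ring
      rw [e]
      have := mul_le_mul_of_nonneg_right hb' (show 0 ≤ ((Q : ℝ) ^ i) ^ p by positivity)
      linarith
    have h2 : m * (1 / (Q : ℝ)) ^ (d + 1) ≤ m * ρ ^ (d + 1) := by gcongr
    have h3 : 0 ≤ m * ρ ^ (d + 1) := by positivity
    have h4 : (c p : ℝ) * (1 + ((0 : ℕ) : ℝ)) = c p := by simp
    rw [h4]
    linarith
  have hhigh : ∀ d, (c (l + (d + 1)) : ℝ) * (1 + ((l + (d + 1)).choose l : ℝ))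
      / ((Q : ℝ) ^ i) ^ (l + (d + 1)) ≤ 2 * m * ρ ^ (d + 1) := by
    intro d
    have ha : (c (l + (d + 1)) : ℝ) ≤ (Q : ℝ) ^ ((i - 1) * (d + 1)) * c l := by
      exact_mod_cast h.above (d + 1)
    have hch : ((l + (d + 1)).choose l : ℝ) ≤ (l + 1 : ℝ) ^ (d + 1) := by
      exact_mod_cast choose_add_le_pow l (d + 1)
    have h1 : (1 : ℝ) ≤ (l + 1 : ℝ) ^ (d + 1) :=
      one_le_pow₀ (by linarith [show (0 : ℝ) ≤ l by positivity])
    calc (c (l + (d + 1)) : ℝ) * (1 + ((l + (d + 1)).choose l : ℝ))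
        / ((Q : ℝ) ^ i) ^ (l + (d + 1))
        ≤ ((Q : ℝ) ^ ((i - 1) * (d + 1)) * c l) * (2 * (l + 1 : ℝ) ^ (d + 1))
        / ((Q : ℝ) ^ i) ^ (l + (d + 1)) := by
          gcongr
          linarith
      _ = 2 * m * ρ ^ (d + 1) := by
          obtain ⟨p, rfl⟩ := Nat.exists_eq_add_of_le hi
          rw [hm, hρ, div_pow, add_tsub_cancel_left]
          have e : ((Q : ℝ) ^ (1 + p)) ^ (l + (d + 1))
              = ((Q : ℝ) ^ (1 + p)) ^ l * (Q : ℝ) ^ (p * (d + 1)) * (Q : ℝ) ^ (d + 1) := by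
            rw [← pow_mul, ← pow_mul, ← pow_add, ← pow_add]
            congr 1
            ring
          rw [e]
          field_simp
  set F : ℕ → ℝ := fun a => (c a : ℝ) * (1 + (a.choose l : ℝ)) / ((Q : ℝ) ^ i) ^ a with hF
  have hF0 : ∀ a, 0 ≤ F a := fun a => by simp only [hF]; positivity
  have hsub : (Finset.range M).erase l ⊆
      Finset.range l ∪ (Finset.range M).image fun d => l + (d + 1) := by
    intro a ha
    obtain ⟨hne, hM⟩ := Finset.mem_erase.1 ha
    rw [Finset.mem_range] at hM
    simp only [Finset.mem_union, Finset.mem_range, Finset.mem_image]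
    rcases lt_or_gt_of_ne hne with h | h
    · exact Or.inl h
    · exact Or.inr ⟨a - l - 1, by omega, by omega⟩
  calc ∑ a ∈ (Finset.range M).erase l, F a
      ≤ ∑ a ∈ Finset.range l ∪ (Finset.range M).image (fun d => l + (d + 1)), F a :=
        Finset.sum_le_sum_of_subset_of_nonneg hsub fun a _ _ => hF0 a
    _ ≤ ∑ a ∈ Finset.range l, F a + ∑ a ∈ (Finset.range M).image (fun d => l + (d + 1)), F a := by
        rw [← Finset.sum_union_inter]
        exact le_add_of_nonneg_right (Finset.sum_nonneg fun a _ => hF0 a)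
    _ = ∑ d ∈ Finset.range l, F (l - 1 - d) + ∑ d ∈ Finset.range M, F (l + (d + 1)) := by
        rw [Finset.sum_range_reflect, Finset.sum_image]
        intro a _ b _ hab
        simpa using hab
    _ ≤ ∑ d ∈ Finset.range l, 2 * m * ρ ^ (d + 1) + ∑ d ∈ Finset.range M, 2 * m * ρ ^ (d + 1) :=
        add_le_add (Finset.sum_le_sum fun d hd => hlow d (Finset.mem_range.1 hd))
          (Finset.sum_le_sum fun d _ => hhigh d)
    _ ≤ 2 * m * (2 * ρ) + 2 * m * (2 * ρ) := by
        rw [← Finset.mul_sum, ← Finset.mul_sum]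
        gcongr <;> exact geom_sum_le_two hρ0 hρ2 _
    _ = 8 * ρ * m := by ring

/-! ### Colourings good for one input. -/

section Colouring

variable {J R : Type*} [Fintype J] [DecidableEq J] [Fintype R] [DecidableEq R]

/-- For at least half of the colourings, the two monochromatic sets are large and differ little
from the corresponding level sets. -/
theorem half_colourings_good {Q i l k H : ℕ} (s : J → Finset R)
    (hdom : DominantLevel (fun a => (Finset.univ.filter fun j => (s j).card = a).card) Q i l)
    (hi : 1 ≤ i) (hl : l ≤ 2 * k) (hk : 1 ≤ k) (hQ : 6 * k ≤ Q)
    (hH : ∀ t, (Finset.univ.filter fun j => t ∈ s j).card ≤ H)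
    {m : ℝ} (hm : m = ((Finset.univ.filter fun j => (s j).card = l).card : ℝ)
      / (((Q ^ i : ℕ) : ℝ)) ^ l) (hm0 : 0 < m) (hmH : 64 * k * H ≤ m)
    (a b : Fin (Q ^ i)) :
    (((Q ^ i : ℕ) : ℝ)) ^ Fintype.card R / 2 ≤
      ((Finset.univ.filter fun g : R → Fin (Q ^ i) =>
        (m / 2 ≤ (monoSet s g a).card ∧ m / 2 ≤ (monoSet s g b).card) ∧
        ((symmDiff (monoSet s g a) (levelSet s g a b l)).card : ℝ) ≤ 192 * k / Q * m ∧
        ((symmDiff (monoSet s g b) (levelSet s g b a l)).card : ℝ) ≤ 192 * k / Q * m).card : ℝ) := by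
  have hK : 0 < Q ^ i := Nat.pow_pos (by omega)
  have hQ0 : (0 : ℝ) < Q := by exact_mod_cast (by omega : 0 < Q)
  have hk0 : (0 : ℝ) < k := by exact_mod_cast hk
  set W : ℝ := (((Q ^ i : ℕ) : ℝ)) ^ Fintype.card R with hW
  -- Four bad events, each of probability at most `1 / 8`, leave half of the colourings. Here
  -- Chebyshev gives `4 l H / m ≤ 8 k H / m ≤ 1 / 8`.
  have hcheb : ∀ a : Fin (Q ^ i), ((Finset.univ.filter fun g : R → Fin (Q ^ i) =>
      ¬ m / 2 ≤ (monoSet s g a).card).card : ℝ) ≤ W / 8 := by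
    intro a
    have h := card_small_monoSet_mul_le hK s a l H hH m hm hm0
    simp only [not_le]
    set X := ((Finset.univ.filter fun g : R → Fin (Q ^ i) =>
      ((monoSet s g a).card : ℝ) < m / 2).card : ℝ)
    have hl' : (l : ℝ) ≤ 2 * k := by exact_mod_cast hl
    have h1 : 4 * (l : ℝ) * H * W ≤ m * (W / 8) := by
      have : (l : ℝ) * H ≤ 2 * k * H := by gcongr
      have hW0 : 0 ≤ W := by positivity
      nlinarith
    have h2 : m * X ≤ m * (W / 8) := by linarith
    exact le_of_mul_le_mul_left h2 hm0
  have hmark : ∀ a b : Fin (Q ^ i), ((Finset.univ.filter fun g : R → Fin (Q ^ i) =>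
      ¬ ((symmDiff (monoSet s g a) (levelSet s g a b l)).card : ℝ) ≤ 192 * k / Q * m).card : ℝ)
        ≤ W / 8 := by
    intro a b
    set e : ℝ := 192 * k / Q * m with he
    have he0 : 0 < e := by positivity
    have h := sum_card_symmDiff_le hK s a b l
    have h2 := hdom.sum_le hi (by omega) (Fintype.card R + 1)
    rw [← hm] at h2
    -- The constant `192` is `8 * 8 * 3`: Markov at eight times the bound on the mean, with `l + 1 ≤
    -- 3 k`.
    have h3 : 8 * ((l + 1 : ℝ) / Q) * m ≤ e / 8 := by
      have : (l + 1 : ℝ) ≤ 3 * k := by exact_mod_cast (by omega : l + 1 ≤ 3 * k)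
      have : 8 * ((l + 1 : ℝ) / Q) * m ≤ 8 * ((3 * k : ℝ) / Q) * m := by gcongr
      refine this.trans (le_of_eq ?_)
      rw [he]; ring
    set B := Finset.univ.filter fun g : R → Fin (Q ^ i) =>
      ¬ ((symmDiff (monoSet s g a) (levelSet s g a b l)).card : ℝ) ≤ e with hB
    have h4 : (B.card : ℝ) * e ≤
        ∑ g : R → Fin (Q ^ i), ((symmDiff (monoSet s g a) (levelSet s g a b l)).card : ℝ) := by
      rw [← nsmul_eq_mul, ← Finset.sum_const]
      calc ∑ _g ∈ B, e ≤ ∑ g ∈ B, ((symmDiff (monoSet s g a) (levelSet s g a b l)).card : ℝ) :=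
            Finset.sum_le_sum fun g hg => (not_le.1 (Finset.mem_filter.1 hg).2).le
        _ ≤ _ := Finset.sum_le_sum_of_subset_of_nonneg (Finset.subset_univ _)
            fun _ _ _ => by positivity
    have h5 : (B.card : ℝ) * e ≤ W / 8 * e := by
      refine h4.trans (h.trans ?_)
      calc W * _ ≤ W * (e / 8) := by
            refine mul_le_mul_of_nonneg_left (h2.trans h3) (by positivity)
        _ = _ := by ring
    exact le_of_mul_le_mul_right h5 he0
  set G := Finset.univ.filter fun g : R → Fin (Q ^ i) =>
        (m / 2 ≤ (monoSet s g a).card ∧ m / 2 ≤ (monoSet s g b).card) ∧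
        ((symmDiff (monoSet s g a) (levelSet s g a b l)).card : ℝ) ≤ 192 * k / Q * m ∧
        ((symmDiff (monoSet s g b) (levelSet s g b a l)).card : ℝ) ≤ 192 * k / Q * m with hG
  set B₁ := Finset.univ.filter fun g : R → Fin (Q ^ i) => ¬ m / 2 ≤ (monoSet s g a).card with hB₁
  set B₂ := Finset.univ.filter fun g : R → Fin (Q ^ i) => ¬ m / 2 ≤ (monoSet s g b).card with hB₂
  set B₃ := Finset.univ.filter fun g : R → Fin (Q ^ i) =>
      ¬ ((symmDiff (monoSet s g a) (levelSet s g a b l)).card : ℝ) ≤ 192 * k / Q * m with hB₃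
  set B₄ := Finset.univ.filter fun g : R → Fin (Q ^ i) =>
      ¬ ((symmDiff (monoSet s g b) (levelSet s g b a l)).card : ℝ) ≤ 192 * k / Q * m with hB₄
  have hcov : (Finset.univ : Finset (R → Fin (Q ^ i))) ⊆ G ∪ (B₁ ∪ (B₂ ∪ (B₃ ∪ B₄))) := by
    intro g _
    simp only [hG, hB₁, hB₂, hB₃, hB₄, Finset.mem_union, Finset.mem_filter, Finset.mem_univ,
      true_and]
    tauto
  have hcard : (Fintype.card (R → Fin (Q ^ i)) : ℝ)
      ≤ G.card + (B₁.card + (B₂.card + (B₃.card + B₄.card))) := by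
    have h1 := Finset.card_le_card hcov
    rw [Finset.card_univ] at h1
    have h2 := Finset.card_union_le G (B₁ ∪ (B₂ ∪ (B₃ ∪ B₄)))
    have h3 := Finset.card_union_le B₁ (B₂ ∪ (B₃ ∪ B₄))
    have h4 := Finset.card_union_le B₂ (B₃ ∪ B₄)
    have h5 := Finset.card_union_le B₃ B₄
    exact_mod_cast (by omega : Fintype.card (R → Fin (Q ^ i))
      ≤ G.card + (B₁.card + (B₂.card + (B₃.card + B₄.card))))
  have hWc : (Fintype.card (R → Fin (Q ^ i)) : ℝ) = W := by
    rw [Fintype.card_fun, Fintype.card_fin]; push_cast [hW]; rfl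
  have h1 := hcheb a
  have h2 := hcheb b
  have h3 := hmark a b
  have h4 := hmark b a
  linarith

end Colouring

/-! ### Rectangles inside a branching program. -/

namespace BranchingProgram

variable {N n : ℕ} {R : Type*} [DecidableEq R]

/-- The segments of time in which the computation on `x` reads the coordinate `j`. -/
def segs (P : BranchingProgram (Fin N) n) (seg : ℕ → R) (x : Fin n → Fin N) (j : Fin n) :
    Finset R :=
  (Finset.univ.filter fun t => P.queryAt x t = j).image fun t : Fin P.time => seg t

theorem mem_segs {P : BranchingProgram (Fin N) n} {seg : ℕ → R} {x : Fin n → Fin N} {j : Fin n}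
    {u : R} : u ∈ P.segs seg x j ↔ ∃ t : Fin P.time, P.queryAt x t = j ∧ seg t = u := by
  simp [segs]

theorem sum_card_segs_le (P : BranchingProgram (Fin N) n) (seg : ℕ → R) (x : Fin n → Fin N) :
    ∑ j, (P.segs seg x j).card ≤ P.time := by
  calc ∑ j, (P.segs seg x j).card
      ≤ ∑ j, (Finset.univ.filter fun t => P.queryAt x t = j).card :=
        Finset.sum_le_sum fun j _ => Finset.card_image_le
    _ = (Finset.univ : Finset (Fin P.time)).card :=
        (Finset.card_eq_sum_card_fiberwise fun t _ => Finset.mem_coe.2 (Finset.mem_univ _)).symm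
    _ = P.time := by simp

theorem card_mem_segs_le (P : BranchingProgram (Fin N) n) (seg : ℕ → R) (x : Fin n → Fin N)
    (u : R) : (Finset.univ.filter fun j => u ∈ P.segs seg x j).card
      ≤ (Finset.univ.filter fun t : Fin P.time => seg t = u).card := by
  refine (Finset.card_le_card (t := (Finset.univ.filter fun t : Fin P.time => seg t = u).image
    (P.queryAt x)) ?_).trans Finset.card_image_le
  intro j hj
  obtain ⟨t, ht, htu⟩ := mem_segs.1 (Finset.mem_filter.1 hj).2
  simp only [Finset.mem_image, Finset.mem_filter, Finset.mem_univ, true_and]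
  exact ⟨t, htu, ht⟩

variable [Fintype R] {K : ℕ}

/-- The part of a computation outside the segments of colour `b` determines the coordinates read
only in those segments. -/
theorem monoSet_levelSet_eq (P : BranchingProgram (Fin N) n) {seg : ℕ → R} {x y : Fin n → Fin N}
    (hb : P.SameBoundary seg x y) (g : R → Fin K) {a b : Fin K} (hab : a ≠ b) (l : ℕ)
    (h : ∀ j, j ∉ monoSet (P.segs seg x) g b → j ∉ monoSet (P.segs seg y) g b → x j = y j) :
    monoSet (P.segs seg x) g b = monoSet (P.segs seg y) g b ∧
      levelSet (P.segs seg x) g a b l = levelSet (P.segs seg y) g a b l := by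
  have hnot : ∀ (z : Fin n → Fin N) (t : Fin P.time), g (seg t) ≠ b →
      P.queryAt z t ∉ monoSet (P.segs seg z) g b := by
    intro z t ht hmem
    exact ht ((Finset.mem_filter.1 hmem).2 _ (mem_segs.2 ⟨t, rfl, rfl⟩))
  -- A coordinate read outside colour `b` is not in the `b`-foot, so the inputs agree on it, and the
  -- computations coincide outside colour `b`.
  have hnode : ∀ t : Fin P.time, g (seg t) ≠ b → P.queryAt x t = P.queryAt y t := by
    intro t ht
    refine P.queryAt_congr (P.nodeAt_eq_of_agree hb {u | g u ≠ b} ?_ t.castSucc ht)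
    intro t ht hq
    exact h _ (hnot x t ht) (by rw [hq]; exact hnot y t ht)
  have hseg : ∀ u, g u ≠ b → ∀ j, u ∈ P.segs seg x j ↔ u ∈ P.segs seg y j := by
    intro u hu j
    simp only [mem_segs]
    refine exists_congr fun t => and_congr_left fun htu => ?_
    rw [hnode t (by rw [htu]; exact hu)]
  constructor
  · ext j
    simp only [monoSet, Finset.mem_filter, Finset.mem_univ, true_and]
    refine forall_congr' fun u => ?_
    by_cases hu : g u = b
    · simp [hu]
    · rw [hseg u hu j]
  · ext j
    simp only [levelSet, Finset.mem_filter, Finset.mem_univ, true_and]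
    have h1 : (P.segs seg x j).filter (fun u => g u = a)
        = (P.segs seg y j).filter fun u => g u = a := by
      ext u
      simp only [Finset.mem_filter]
      exact and_congr_left fun hu => hseg u (by rw [hu]; exact hab) j
    rw [h1]
    refine and_congr_right fun _ => forall_congr' fun u => ?_
    by_cases hu : g u = b
    · simp [hu]
    · rw [hseg u hu j]

/-- Inputs with distinct values whose computations agree at the boundaries of the segments, for
which the monochromatic sets deviate in the same way from the level sets, are few. -/
theorem card_mul_two_pow_le (hn : 2 ≤ n) (P : BranchingProgram (Fin N) n)
    (hP : P.Computes (elementDistinctness n N)) {seg : ℕ → R} (g : R → Fin K) {a b : Fin K}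
    (hab : a ≠ b) {l f : ℕ} {A B : Finset (Fin n)} (E : Finset (Fin n → Fin N))
    (hinj : ∀ x ∈ E, Function.Injective x)
    (hb : ∀ x ∈ E, ∀ y ∈ E, P.SameBoundary seg x y)
    (hA : ∀ x ∈ E, symmDiff (monoSet (P.segs seg x) g a) (levelSet (P.segs seg x) g a b l) = A)
    (hB : ∀ x ∈ E, symmDiff (monoSet (P.segs seg x) g b) (levelSet (P.segs seg x) g b a l) = B)
    (hfa : ∀ x ∈ E, f ≤ (monoSet (P.segs seg x) g a).card)
    (hfb : ∀ x ∈ E, f ≤ (monoSet (P.segs seg x) g b).card) :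
    (E.card : ℝ) * 2 ^ f ≤ 2 * (N : ℝ) ^ n := by
  refine card_mul_two_pow_le_of_rectangles E (fun x => monoSet (P.segs seg x) g a)
    (fun x => monoSet (P.segs seg x) g b) ?_ ?_ ?_ hfa hfb
  · intro x hx y hy hFa hFb hxy i hi j hj
    -- The feet are disjoint because every coordinate is read somewhere: an unread one would lie in
    -- both vacuously.
    have hja : j ∉ monoSet (P.segs seg x) g a := by
      intro hja
      obtain ⟨t, ht⟩ := P.exists_queryAt_eq hn hP (hinj x hx) j
      have hmem : seg t ∈ P.segs seg x j := mem_segs.2 ⟨t, ht, rfl⟩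
      exact hab (((Finset.mem_filter.1 hja).2 _ hmem).symm.trans ((Finset.mem_filter.1 hj).2 _ hmem))
    -- The computation on `w` follows `x` in the segments of colour `a` and `y` in all others, hence
    -- ends at an accepting sink; so `w` is injective.
    let w : Fin n → Fin N := fun i => if i ∈ monoSet (P.segs seg x) g a then x i else y i
    have hmix := P.nodeAt_mix (y := w) (hb x hx y hy) {u | g u = a} (by
      intro t ht
      by_cases hq : P.queryAt x t ∈ monoSet (P.segs seg x) g a
      · simp [w, hq]
      · simp only [w, hq, if_false]
        refine hxy _ hq fun hq' => ?_
        have := (Finset.mem_filter.1 hq').2 _ (mem_segs.2 ⟨t, rfl, rfl⟩)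
        exact hab (Eq.trans (Eq.symm ht) this)) (by
      intro t ht
      have hq : P.queryAt y t ∉ monoSet (P.segs seg x) g a := by
        intro hq
        rw [hFa] at hq
        exact ht ((Finset.mem_filter.1 hq).2 _ (mem_segs.2 ⟨t, rfl, rfl⟩))
      simp [w, hq]) (Fin.last P.time)
    have hout : P.output w = true := by
      have hx' := hP x
      have hy' := hP y
      simp only [elementDistinctness, hinj x hx, hinj y hy, decide_true, output] at hx' hy' ⊢
      by_cases hs : seg (Fin.last P.time : Fin (P.time + 1)) ∈ {u | g u = a}
      · rw [← hmix.1 hs, hx']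
      · rw [← hmix.2 hs, hy']
    rw [hP w] at hout
    have hw : Function.Injective w := by simpa [elementDistinctness] using hout
    intro heq
    have hij : i = j := hw (by simp [w, hi, hja, heq])
    exact hja (hij ▸ hi)
  · intro x hx y hy h
    obtain ⟨h1, h2⟩ := P.monoSet_levelSet_eq (hb x hx y hy) g hab.symm l h
    refine ⟨h1, ?_⟩
    -- The other foot is its visible prediction corrected by the fixed set `B`.
    have hx' := hB x hx
    rw [← hB y hy, h2] at hx'
    exact symmDiff_left_injective _ hx'
  · intro x hx y hy h
    obtain ⟨h1, h2⟩ := P.monoSet_levelSet_eq (hb x hx y hy) g hab l h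
    refine ⟨?_, h1⟩
    have hx' := hA x hx
    rw [← hA y hy, h2] at hx'
    exact symmDiff_left_injective _ hx'

end BranchingProgram

/-! ### Counting tools. -/

theorem card_le_card_mul_of_fibres {α β : Type*} [DecidableEq β] {s : Finset α} {t : Finset β}
    {f : α → β} {B : ℝ} (hf : ∀ a ∈ s, f a ∈ t)
    (hB : ∀ b ∈ t, ((s.filter fun a => f a = b).card : ℝ) ≤ B) : (s.card : ℝ) ≤ t.card * B := by
  rw [Finset.card_eq_sum_card_fiberwise (f := f) (t := t) (fun a ha => hf a ha)]
  push_cast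
  rw [← nsmul_eq_mul]
  exact Finset.sum_le_card_nsmul _ _ _ hB

/-- If every element of `s` is related to half of a finite type, and every element of that type to
at most `B` elements of `s`, then `s` has at most `2 B` elements. -/
theorem card_le_two_mul_of_half {α γ : Type*} [Fintype γ] [Nonempty γ] {s : Finset α}
    (r : α → γ → Prop) [∀ a g, Decidable (r a g)] {B : ℝ}
    (h : ∀ a ∈ s, (Fintype.card γ : ℝ) / 2 ≤ ((Finset.univ.filter fun g => r a g).card : ℝ))
    (hB : ∀ g, ((s.filter fun a => r a g).card : ℝ) ≤ B) : (s.card : ℝ) ≤ 2 * B := by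
  have hdc : ∑ a ∈ s, ((Finset.univ.filter fun g => r a g).card : ℝ)
      = ∑ g, ((s.filter fun a => r a g).card : ℝ) := by
    have := Finset.sum_card_bipartiteAbove_eq_sum_card_bipartiteBelow (s := s)
      (t := (Finset.univ : Finset γ)) r
    simp only [Finset.bipartiteAbove, Finset.bipartiteBelow] at this
    exact_mod_cast this
  have h1 : (s.card : ℝ) * ((Fintype.card γ : ℝ) / 2) ≤ Fintype.card γ * B := by
    calc (s.card : ℝ) * ((Fintype.card γ : ℝ) / 2)
        = ∑ a ∈ s, (Fintype.card γ : ℝ) / 2 := by rw [Finset.sum_const, nsmul_eq_mul]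
      _ ≤ ∑ a ∈ s, ((Finset.univ.filter fun g => r a g).card : ℝ) := Finset.sum_le_sum h
      _ = ∑ g, ((s.filter fun a => r a g).card : ℝ) := hdc
      _ ≤ ∑ _g : γ, B := Finset.sum_le_sum fun g _ => hB g
      _ = Fintype.card γ * B := by simp
  have hpos : (0 : ℝ) < Fintype.card γ := by exact_mod_cast Fintype.card_pos
  have h2 : (Fintype.card γ : ℝ) * s.card ≤ Fintype.card γ * (2 * B) := by linarith
  exact le_of_mul_le_mul_left h2 hpos

/-- Weight every element by `2 ^ (-u)`: all subsets together weigh `(1 + 2 ^ (-u)) ^ n`, and each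
small one weighs at least `2 ^ (-u e)`. The free parameter `u` is the price in bits per element. -/
theorem card_small_subsets_le (n u : ℕ) {e : ℝ} :
    ((Finset.univ.filter fun S : Finset (Fin n) => (S.card : ℝ) ≤ e).card : ℝ)
      ≤ 2 ^ ((u : ℝ) * e + 2 * n / 2 ^ u) := by
  set Z := Finset.univ.filter fun S : Finset (Fin n) => (S.card : ℝ) ≤ e with hZ
  have hsum : ∑ S : Finset (Fin n), ((1 : ℝ) / 2 ^ u) ^ S.card = (1 / 2 ^ u + 1) ^ n := by
    have := Fintype.sum_pow_mul_eq_add_pow (Fin n) ((1 : ℝ) / 2 ^ u) 1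
    simpa using this
  have hlow : (Z.card : ℝ) * 2 ^ (-((u : ℝ) * e)) ≤ ∑ S : Finset (Fin n), ((1 : ℝ) / 2 ^ u) ^ S.card := by
    rw [← nsmul_eq_mul, ← Finset.sum_const]
    calc ∑ _S ∈ Z, (2 : ℝ) ^ (-((u : ℝ) * e)) ≤ ∑ S ∈ Z, ((1 : ℝ) / 2 ^ u) ^ S.card := by
          refine Finset.sum_le_sum fun S hS => ?_
          have hS' := (Finset.mem_filter.1 hS).2
          have : ((1 : ℝ) / 2 ^ u) ^ S.card = 2 ^ (-((u : ℝ) * S.card)) := by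
            rw [Real.rpow_neg (by norm_num), Real.rpow_mul (by norm_num), Real.rpow_natCast,
              Real.rpow_natCast, one_div, inv_pow]
          rw [this]
          refine Real.rpow_le_rpow_of_exponent_le (by norm_num) ?_
          gcongr
      _ ≤ _ := Finset.sum_le_sum_of_subset_of_nonneg (Finset.subset_univ _)
          fun _ _ _ => by positivity
  have hup : ((1 : ℝ) / 2 ^ u + 1) ^ n ≤ 2 ^ ((2 : ℝ) * n / 2 ^ u) := by
    have h1 : ((1 : ℝ) / 2 ^ u + 1) ^ n ≤ Real.exp (n * (1 / 2 ^ u)) := by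
      rw [Real.exp_nat_mul]
      gcongr
      exact Real.add_one_le_exp _
    refine h1.trans ?_
    rw [Real.rpow_def_of_pos (by norm_num)]
    refine Real.exp_le_exp.2 ?_
    have hlog := Real.log_two_gt_d9
    have h2 : (0 : ℝ) ≤ n / 2 ^ u := by positivity
    calc (n : ℝ) * (1 / 2 ^ u) = 1 * (n / 2 ^ u) := by ring
      _ ≤ (2 * Real.log 2) * (n / 2 ^ u) := by gcongr; linarith
      _ = _ := by ring
  have h := hlow.trans (hsum.le.trans hup)
  rw [Real.rpow_neg (by norm_num), ← div_eq_mul_inv, div_le_iff₀ (by positivity)] at h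
  rw [Real.rpow_add (by norm_num)]
  linarith

/-- The count is at least `(n² + 1 - n) ^ n`, and Bernoulli's inequality bounds `(1 - (n - 1) / n²)
^ n` below by `1 / n`. -/
theorem pow_div_le_card_injective (n : ℕ) (hn : 1 ≤ n) :
    ((n ^ 2 : ℕ) : ℝ) ^ n / n ≤
      ((Finset.univ.filter fun x : Fin n → Fin (n ^ 2) => Function.Injective x).card : ℝ) := by
  classical
  have hcard : (Finset.univ.filter fun x : Fin n → Fin (n ^ 2) => Function.Injective x).card
      = (n ^ 2).descFactorial n := by
    have h := Fintype.card_embedding_eq (α := Fin n) (β := Fin (n ^ 2))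
    rw [Fintype.card_fin, Fintype.card_fin] at h
    rw [← h, ← Fintype.card_subtype]
    exact Fintype.card_congr (Equiv.subtypeInjectiveEquivEmbedding _ _)
  rw [hcard]
  have h1 : (n ^ 2 + 1 - n) ^ n ≤ (n ^ 2).descFactorial n := Nat.pow_sub_le_descFactorial _ _
  have h2 : ((n ^ 2 + 1 - n : ℕ) : ℝ) = (n : ℝ) ^ 2 + 1 - n := by
    rw [Nat.cast_sub (by nlinarith)]; push_cast; ring
  have h3 : ((n : ℝ) ^ 2 + 1 - n) ^ n ≤ ((n ^ 2).descFactorial n : ℝ) := by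
    rw [← h2]; exact_mod_cast h1
  refine le_trans ?_ h3
  have hn0 : (1 : ℝ) ≤ n := by exact_mod_cast hn
  have hb := one_add_mul_le_pow (a := -((n - 1 : ℝ) / n ^ 2)) (by
    have : (n - 1 : ℝ) / n ^ 2 ≤ 2 := by
      rw [div_le_iff₀ (by positivity)]; nlinarith
    linarith) n
  have e1 : 1 + (n : ℝ) * -((n - 1 : ℝ) / n ^ 2) = 1 / n := by field_simp; ring
  have e2 : (n : ℝ) ^ 2 + 1 - n = n ^ 2 * (1 + -((n - 1 : ℝ) / n ^ 2)) := by field_simp; ring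
  rw [e1] at hb
  rw [e2, mul_pow]
  push_cast
  rw [div_eq_mul_one_div]
  gcongr

/-! ### Many boundary states. -/

namespace BranchingProgram

variable {N n : ℕ} {R : Type*} [DecidableEq R]

/-- The number of possible sequences of boundary nodes. -/
def boundaryStates (P : BranchingProgram (Fin N) n) (seg : ℕ → R) : ℕ :=
  ∏ t ∈ Finset.univ.filter (fun t : Fin P.time => seg (t + 1) ≠ seg t), P.width t.succ

variable [Fintype R] {K : ℕ}

/-- For a fixed colouring, inputs are classified by their boundary nodes and the two prediction
errors; each class obeys the rectangle bound with `f = ⌈m / 2⌉`. -/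
theorem card_good_inputs_le (hn : 2 ≤ n) (P : BranchingProgram (Fin N) n)
    (hP : P.Computes (elementDistinctness n N)) (seg : ℕ → R) (g : R → Fin K) {a b : Fin K}
    (hab : a ≠ b) {l u : ℕ} {m e : ℝ} (E : Finset (Fin n → Fin N))
    (hinj : ∀ x ∈ E, Function.Injective x)
    (hE : ∀ x ∈ E, (m / 2 ≤ (monoSet (P.segs seg x) g a).card ∧
        m / 2 ≤ (monoSet (P.segs seg x) g b).card) ∧
      ((symmDiff (monoSet (P.segs seg x) g a) (levelSet (P.segs seg x) g a b l)).card : ℝ) ≤ e ∧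
      ((symmDiff (monoSet (P.segs seg x) g b) (levelSet (P.segs seg x) g b a l)).card : ℝ) ≤ e) :
    (E.card : ℝ) ≤ P.boundaryStates seg * (2 ^ ((u : ℝ) * e + 2 * n / 2 ^ u)) ^ 2
      * (2 * (N : ℝ) ^ n / 2 ^ (m / 2)) := by
  classical
  let Bd := Finset.univ.filter fun t : Fin P.time => seg (t + 1) ≠ seg t
  let Z := Finset.univ.filter fun S : Finset (Fin n) => (S.card : ℝ) ≤ e
  let φ : (Fin n → Fin N) → ((t : Bd) → Fin (P.width t.1.succ)) × Finset (Fin n) × Finset (Fin n) :=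
    fun x => (fun t => P.nodeAt x t.1.succ,
      symmDiff (monoSet (P.segs seg x) g a) (levelSet (P.segs seg x) g a b l),
      symmDiff (monoSet (P.segs seg x) g b) (levelSet (P.segs seg x) g b a l))
  have hfib := card_le_card_mul_of_fibres (s := E) (t := Finset.univ ×ˢ Z ×ˢ Z) (f := φ)
    (B := 2 * (N : ℝ) ^ n / 2 ^ (m / 2)) (by
      intro x hx
      simp only [φ, Z, Finset.mem_product, Finset.mem_univ, Finset.mem_filter, true_and]
      exact (hE x hx).2) (by
      rintro ⟨v, A, B⟩ -
      have hsub : ∀ x ∈ E.filter (fun x => φ x = (v, A, B)), x ∈ E := fun x hx =>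
        (Finset.mem_filter.1 hx).1
      have hφ : ∀ x ∈ E.filter (fun x => φ x = (v, A, B)), φ x = (v, A, B) := fun x hx =>
        (Finset.mem_filter.1 hx).2
      have h := P.card_mul_two_pow_le hn hP (seg := seg) g hab (l := l) (f := ⌈m / 2⌉₊) (A := A)
        (B := B) (E.filter fun x => φ x = (v, A, B)) (fun x hx => hinj x (hsub x hx))
        (fun x hx y hy t ht => by
          have h1 := congrArg Prod.fst ((hφ x hx).trans (hφ y hy).symm)
          exact congrFun h1 ⟨t, Finset.mem_filter.2 ⟨Finset.mem_univ _, ht⟩⟩)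
        (fun x hx => congrArg (fun p => p.2.1) (hφ x hx))
        (fun x hx => congrArg (fun p => p.2.2) (hφ x hx))
        (fun x hx => Nat.ceil_le.2 (hE x (hsub x hx)).1.1)
        (fun x hx => Nat.ceil_le.2 (hE x (hsub x hx)).1.2)
      rw [le_div_iff₀ (by positivity)]
      refine le_trans ?_ h
      rw [← Real.rpow_natCast]
      gcongr
      · norm_num
      · exact Nat.le_ceil _)
  refine hfib.trans ?_
  gcongr
  rw [Finset.card_product, Finset.card_product, Finset.card_univ, Fintype.card_pi]
  have hbs : ∏ t : Bd, Fintype.card (Fin (P.width t.1.succ)) = P.boundaryStates seg := by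
    simp only [Fintype.card_fin, boundaryStates]
    exact Finset.prod_coe_sort Bd fun t => P.width t.succ
  rw [hbs]
  push_cast
  have hZ := card_small_subsets_le n u (e := e)
  rw [sq]
  gcongr

/-- A program for Element Distinctness has many sequences of boundary nodes. -/
theorem two_rpow_le_boundaryStates (hn : 2 ≤ n) (P : BranchingProgram (Fin (n ^ 2)) n)
    (hP : P.Computes (elementDistinctness n (n ^ 2))) (seg : ℕ → R) {k κ H : ℕ} (hk : 2 ≤ k)
    (hκ : 1 ≤ κ) (hkκ : k ≤ 2 ^ κ) (htime : P.time ≤ k * n)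
    (hH : ∀ v, (Finset.univ.filter fun t : Fin P.time => seg t = v).card ≤ H) {μ : ℝ}
    (hμ : μ = (n : ℝ) / ((2 : ℝ) ^ (32 * κ)) ^ (10 * k ^ 2)) (hμH : 64 * k * H ≤ μ)
    (hbig : 64 * (k : ℝ) ^ 2 * n ^ 2 ≤ 2 ^ (μ / 8)) :
    (2 : ℝ) ^ (μ / 4) ≤ P.boundaryStates seg := by
  classical
  set Q : ℕ := 2 ^ (32 * κ) with hQdef
  have hQR : (Q : ℝ) = (2 : ℝ) ^ (32 * κ) := by rw [hQdef]; push_cast; rfl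
  have hn0 : (0 : ℝ) < n := by exact_mod_cast (by omega : 0 < n)
  have hk0 : (0 : ℝ) < k := by exact_mod_cast (by omega : 0 < k)
  have hQk : 6 * k ≤ Q := by
    calc 6 * k ≤ 2 ^ 3 * 2 ^ κ := Nat.mul_le_mul (by norm_num) hkκ
      _ = 2 ^ (3 + κ) := (pow_add _ _ _).symm
      _ ≤ Q := Nat.pow_le_pow_right (by norm_num) (by omega)
  have hQ0 : (0 : ℝ) < Q := by exact_mod_cast (by omega : 0 < Q)
  have hQ1 : (1 : ℝ) ≤ Q := by exact_mod_cast (by omega : 1 ≤ Q)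
  rw [← hQR] at hμ
  have hμ0 : 0 < μ := by rw [hμ]; positivity
  -- Chosen so that `2 n / 2 ^ u = μ / 32`.
  set u : ℕ := 32 * κ * (10 * k ^ 2) + 6 with hu
  have hu2 : (2 : ℝ) ^ u = 64 * (Q : ℝ) ^ (10 * k ^ 2) := by
    rw [hu, pow_add, pow_mul, hQR]; norm_num; ring
  -- Recording an error of size `192 k m / Q` costs at most `m / 32` bits. The exponent `32 κ` of
  -- `Q` leaves room: `22 + 4 κ` is enough.
  have huQ : (u : ℝ) * (192 * k / Q) ≤ 1 / 32 := by
    have h1 : u * (192 * k) * 32 ≤ Q := by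
      have hκ2 : κ ≤ 2 ^ κ := Nat.lt_two_pow_self.le
      have hone : 1 ≤ 2 ^ κ := Nat.one_le_two_pow
      have h2 : u ≤ 326 * (2 ^ κ) ^ 3 := by
        have : κ * k ^ 2 ≤ 2 ^ κ * (2 ^ κ) ^ 2 := Nat.mul_le_mul hκ2 (Nat.pow_le_pow_left hkκ 2)
        have h3 : 1 ≤ (2 ^ κ) ^ 3 := Nat.one_le_pow _ _ (by omega)
        rw [hu]
        nlinarith
      calc u * (192 * k) * 32 ≤ 326 * (2 ^ κ) ^ 3 * (192 * 2 ^ κ) * 32 := by gcongr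
        _ = 2002944 * (2 ^ κ) ^ 4 := by ring
        _ ≤ 2 ^ 22 * (2 ^ κ) ^ 4 := by gcongr; norm_num
        _ = 2 ^ (22 + κ * 4) := by rw [pow_add, pow_mul]
        _ ≤ Q := Nat.pow_le_pow_right (by norm_num) (by omega)
    have h1' : (u : ℝ) * (192 * k) * 32 ≤ Q := by exact_mod_cast h1
    rw [mul_div_assoc', div_le_iff₀ hQ0]
    linarith
  set X := Finset.univ.filter fun x : Fin n → Fin (n ^ 2) => Function.Injective x with hX
  let lev : (Fin n → Fin (n ^ 2)) → ℕ → ℕ := fun x a =>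
    (Finset.univ.filter fun j => (P.segs seg x j).card = a).card
  have hsel : ∀ x ∈ X, ∃ i l, 1 ≤ i ∧ i ≤ 4 * k ∧ 1 ≤ l ∧ l ≤ 2 * k ∧
      DominantLevel (lev x) Q i l ∧ μ ≤ (lev x l : ℝ) / ((Q ^ i : ℕ) : ℝ) ^ l := by
    intro x hx
    have hx' := (Finset.mem_filter.1 hx).2
    have hpos : ∀ j, 1 ≤ (P.segs seg x j).card := by
      intro j
      obtain ⟨t, ht⟩ := P.exists_queryAt_eq hn hP hx' j
      exact Finset.card_pos.2 ⟨seg t, mem_segs.2 ⟨t, ht, rfl⟩⟩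
    obtain ⟨l₀, hl₀, hl₀k, hpop⟩ := exists_popular_level (fun j => (P.segs seg x j).card)
      (k := k) (by omega) hpos (by
        rw [Fintype.card_fin]; exact (P.sum_card_segs_le seg x).trans htime)
      (by rw [Fintype.card_fin]; omega)
    rw [Fintype.card_fin] at hpop
    obtain ⟨i, l, hi, hiL, hl, hlL, hdom, hlow⟩ := exists_dominantLevel (c := lev x) (Q := Q)
      (n := n) (B := 4 * k) (L := 2 * k) (l₀ := l₀)
      (by
        simp only [lev, Finset.card_eq_zero, Finset.filter_eq_empty_iff]
        intro j _
        exact (Finset.card_pos.1 (hpos j)).ne_empty)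
      (fun l => by simpa using Finset.card_le_univ (Finset.univ.filter fun j =>
        (P.segs seg x j).card = l))
      hl₀ hl₀k hpop (by omega) (by omega) (by omega)
    refine ⟨i, l, hi, by omega, hl, hlL, hdom, ?_⟩
    push_cast
    refine le_trans ?_ hlow
    rw [hμ, div_le_div_iff₀ (by positivity) (by positivity)]
    have h1 : (n : ℝ) ≤ Q * lev x l₀ := by
      exact_mod_cast hpop.trans (Nat.mul_le_mul_right _ (by omega))
    -- This fixes the exponent `10 k²`: with `L = 2 k` it is `8 k² + 2 k`, plus one factor `Q` that
    -- absorbs the loss `4 k` of the popular level.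
    have h2 : (Q : ℝ) * (Q : ℝ) ^ ((2 * (2 * k) + 1) * (2 * k)) ≤ (Q : ℝ) ^ (10 * k ^ 2) := by
      rw [← pow_succ']
      refine pow_le_pow_right₀ hQ1 ?_
      nlinarith
    calc (n : ℝ) * (Q : ℝ) ^ ((2 * (2 * k) + 1) * (2 * k))
        ≤ Q * lev x l₀ * (Q : ℝ) ^ ((2 * (2 * k) + 1) * (2 * k)) := by gcongr
      _ = lev x l₀ * (Q * (Q : ℝ) ^ ((2 * (2 * k) + 1) * (2 * k))) := by ring
      _ ≤ _ := by gcongr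
  choose! I L hI1 hIk hL1 hLk hdom hm using hsel
  set Bs : ℝ := (P.boundaryStates seg : ℝ) with hBs
  have hBs0 : 0 ≤ Bs := by positivity
  -- Scale, level and population of the level are frozen, so that the number of colours and `m` are
  -- constant on each class.
  have hmain := card_le_card_mul_of_fibres (s := X)
    (t := Finset.Icc 1 (4 * k) ×ˢ Finset.Icc 1 (2 * k) ×ˢ Finset.range (n + 1))
    (f := fun x => (I x, L x, lev x (L x)))
    (B := 2 * (Bs * (2 * ((n ^ 2 : ℕ) : ℝ) ^ n) / 2 ^ (3 * μ / 8))) (by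
      intro x hx
      simp only [Finset.mem_product, Finset.mem_Icc, Finset.mem_range]
      refine ⟨⟨hI1 x hx, hIk x hx⟩, ⟨hL1 x hx, hLk x hx⟩, Nat.lt_succ_of_le ?_⟩
      simpa using Finset.card_le_univ (Finset.univ.filter fun j =>
        (P.segs seg x j).card = L x)) (by
      rintro ⟨i, l, ν⟩ hilν
      simp only [Finset.mem_product, Finset.mem_Icc, Finset.mem_range] at hilν
      obtain ⟨⟨hi1, -⟩, ⟨-, hlk⟩, -⟩ := hilν
      set Xi := X.filter fun x => (I x, L x, lev x (L x)) = (i, l, ν) with hXi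
      have hXi' : ∀ x ∈ Xi, x ∈ X ∧ I x = i ∧ L x = l ∧ lev x l = ν := by
        intro x hx
        obtain ⟨h1, h2⟩ := Finset.mem_filter.1 hx
        simp only [Prod.mk.injEq] at h2
        exact ⟨h1, h2.1, h2.2.1, by rw [← h2.2.1]; exact h2.2.2⟩
      set m : ℝ := (ν : ℝ) / ((Q ^ i : ℕ) : ℝ) ^ l with hmdef
      rcases Xi.eq_empty_or_nonempty with h0 | ⟨x₀, hx₀⟩
      · rw [h0, Finset.card_empty, Nat.cast_zero]; positivity
      have hμm : μ ≤ m := by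
        obtain ⟨h1, h2, h3, h4⟩ := hXi' x₀ hx₀
        have := hm x₀ h1
        rw [h2, h3, h4] at this
        exact this
      have hKi : 2 ≤ Q ^ i := (by omega : 2 ≤ Q).trans (Nat.le_self_pow (by omega) Q)
      let a : Fin (Q ^ i) := ⟨0, by omega⟩
      let b : Fin (Q ^ i) := ⟨1, by omega⟩
      have hab : a ≠ b := by simp [a, b, Fin.ext_iff]
      have : Nonempty (R → Fin (Q ^ i)) := ⟨fun _ => a⟩
      refine card_le_two_mul_of_half (γ := R → Fin (Q ^ i)) (fun x g =>
        (m / 2 ≤ (monoSet (P.segs seg x) g a).card ∧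
          m / 2 ≤ (monoSet (P.segs seg x) g b).card) ∧
        ((symmDiff (monoSet (P.segs seg x) g a) (levelSet (P.segs seg x) g a b l)).card : ℝ)
          ≤ 192 * k / Q * m ∧
        ((symmDiff (monoSet (P.segs seg x) g b) (levelSet (P.segs seg x) g b a l)).card : ℝ)
          ≤ 192 * k / Q * m) ?_ ?_
      · intro x hx
        obtain ⟨h1, h2, h3, h4⟩ := hXi' x hx
        have hd := hdom x h1
        rw [h2, h3] at hd
        have := half_colourings_good (k := k) (H := H) (P.segs seg x) hd hi1 hlk (by omega) hQk
          (fun v => (P.card_mem_segs_le seg x v).trans (hH v)) (m := m)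
          (by rw [hmdef, ← h4]) (hμ0.trans_le hμm) (hμH.trans hμm) a b
        rw [Fintype.card_fun, Fintype.card_fin]
        push_cast at this ⊢
        exact this
      · intro g
        have := P.card_good_inputs_le hn hP seg g hab (l := l) (u := u) (m := m)
          (e := 192 * k / Q * m) (Xi.filter fun x =>
          (m / 2 ≤ (monoSet (P.segs seg x) g a).card ∧
            m / 2 ≤ (monoSet (P.segs seg x) g b).card) ∧
          ((symmDiff (monoSet (P.segs seg x) g a) (levelSet (P.segs seg x) g a b l)).card : ℝ)
            ≤ 192 * k / Q * m ∧
          ((symmDiff (monoSet (P.segs seg x) g b) (levelSet (P.segs seg x) g b a l)).card : ℝ)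
            ≤ 192 * k / Q * m)
          (fun x hx => (Finset.mem_filter.1 (hXi' x (Finset.mem_filter.1 hx).1).1).2)
          (fun x hx => (Finset.mem_filter.1 hx).2)
        refine this.trans ?_
        have hm0 : 0 ≤ m := hμ0.le.trans hμm
        -- Bit budget: the two errors cost `m / 16` each, the rectangle bound gains `m / 2`, for a
        -- net gain of at least `3 μ / 8`.
        have he1 : (u : ℝ) * (192 * k / Q * m) + 2 * n / 2 ^ u ≤ m / 16 := by
          have e1 : 2 * (n : ℝ) / 2 ^ u = μ / 32 := by
            rw [hu2, hμ]; field_simp; norm_num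
          have e2 : (u : ℝ) * (192 * k / Q * m) ≤ 1 / 32 * m := by
            rw [← mul_assoc]; gcongr
          rw [e1]
          linarith
        have he2 : ((2 : ℝ) ^ ((u : ℝ) * (192 * k / Q * m) + 2 * n / 2 ^ u)) ^ 2
            ≤ 2 ^ (m / 8) := by
          rw [← Real.rpow_natCast, ← Real.rpow_mul (by norm_num)]
          refine Real.rpow_le_rpow_of_exponent_le (by norm_num) ?_
          push_cast
          linarith
        have he3 : (2 : ℝ) ^ (m / 8) / 2 ^ (m / 2) ≤ 1 / 2 ^ (3 * μ / 8) := by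
          rw [← Real.rpow_sub (by norm_num), one_div, ← Real.rpow_neg (by norm_num)]
          refine Real.rpow_le_rpow_of_exponent_le (by norm_num) ?_
          linarith
        calc Bs * ((2 : ℝ) ^ ((u : ℝ) * (192 * k / Q * m) + 2 * n / 2 ^ u)) ^ 2
              * (2 * ((n ^ 2 : ℕ) : ℝ) ^ n / 2 ^ (m / 2))
            ≤ Bs * 2 ^ (m / 8) * (2 * ((n ^ 2 : ℕ) : ℝ) ^ n / 2 ^ (m / 2)) := by gcongr
          _ = Bs * (2 * ((n ^ 2 : ℕ) : ℝ) ^ n) * (2 ^ (m / 8) / 2 ^ (m / 2)) := by ring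
          _ ≤ Bs * (2 * ((n ^ 2 : ℕ) : ℝ) ^ n) * (1 / 2 ^ (3 * μ / 8)) := by gcongr
          _ = _ := by ring)
  have hinj := (pow_div_le_card_injective n (by omega)).trans hmain
  rw [Finset.card_product, Finset.card_product, Nat.card_Icc, Nat.card_Icc, Finset.card_range]
    at hinj
  simp only [add_tsub_cancel_right] at hinj
  push_cast at hinj
  set D : ℝ := ((n : ℝ) ^ 2) ^ n with hD
  have hD0 : 0 < D := by positivity
  have hn2 : (n : ℝ) + 1 ≤ 2 * n := by
    have : (1 : ℝ) ≤ n := by exact_mod_cast (by omega : 1 ≤ n)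
    linarith
  -- The polynomial losses (classes, colourings, rectangles, density `1 / n`) use up `μ / 8` of the
  -- gain, by `hbig`.
  have h1 : D * 2 ^ (3 * μ / 8) ≤ D * (2 ^ (μ / 8) * Bs) := by
    rw [div_le_iff₀ hn0] at hinj
    have h2 : (0 : ℝ) < 2 ^ (3 * μ / 8) := by positivity
    calc D * 2 ^ (3 * μ / 8) ≤ (4 * (k : ℝ) * (2 * k * (n + 1))
          * (2 * (Bs * (2 * D) / 2 ^ (3 * μ / 8))) * n) * 2 ^ (3 * μ / 8) := by gcongr
      _ = 32 * k ^ 2 * n * (n + 1) * (D * Bs) := by field_simp; ring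
      _ ≤ 32 * k ^ 2 * n * (2 * n) * (D * Bs) := by gcongr
      _ = 64 * (k : ℝ) ^ 2 * n ^ 2 * (D * Bs) := by ring
      _ ≤ 2 ^ (μ / 8) * (D * Bs) := by gcongr
      _ = _ := by ring
  have h2 := le_of_mul_le_mul_left h1 hD0
  have h3 : (2 : ℝ) ^ (3 * μ / 8) = 2 ^ (μ / 8) * 2 ^ (μ / 4) := by
    rw [← Real.rpow_add (by norm_num)]; congr 1; ring
  rw [h3] at h2
  exact le_of_mul_le_mul_left h2 (by positivity)

end BranchingProgram

/-! ### Averaging over the offset of the cut. -/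

namespace BranchingProgram

variable {n : ℕ}

theorem one_le_width {N : ℕ} [NeZero N] (P : BranchingProgram (Fin N) n) (t : Fin (P.time + 1)) :
    1 ≤ P.width t :=
  (Nat.zero_le _).trans_lt (P.nodeAt (fun _ => 0) t).2

/-- The segment of time `t`, when time is cut into segments of length `h`, with offset `c`. -/
def segment (τ h c t : ℕ) : Fin (τ + h + 1) := Fin.ofNat (τ + h + 1) ((t + c) / h)

theorem dvd_of_segment_ne {τ h c t : ℕ} (hne : segment τ h c (t + 1) ≠ segment τ h c t) :
    h ∣ t + 1 + c := by
  by_contra hd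
  refine hne ?_
  unfold segment
  rw [show t + 1 + c = t + c + 1 by ring] at hd ⊢
  rw [Nat.succ_div_of_not_dvd hd]

theorem card_segment_le {τ h c : ℕ} (hh : 0 < h) (hc : c < h) (v : Fin (τ + h + 1)) :
    (Finset.univ.filter fun t : Fin τ => segment τ h c t = v).card ≤ h := by
  have hmaps : ∀ t ∈ Finset.univ.filter (fun t : Fin τ => segment τ h c t = v),
      ((t : ℕ) + c) % h ∈ Finset.range h := fun t _ => Finset.mem_range.2 (Nat.mod_lt _ hh)
  refine (Finset.card_le_card_of_injOn _ hmaps ?_).trans (by simp)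
  intro t ht t' ht' heq
  have hval : ∀ t ∈ Finset.univ.filter (fun t : Fin τ => segment τ h c t = v),
      ((t : ℕ) + c) / h = v := by
    intro t ht
    have h1 := congrArg Fin.val (Finset.mem_filter.1 ht).2
    -- For `t < τ` and `c < h` the reduction modulo `τ + h + 1` never acts.
    rw [segment, Fin.val_ofNat, Nat.mod_eq_of_lt] at h1
    · exact h1
    · have := Nat.div_le_self ((t : ℕ) + c) h
      have := t.2
      omega
  have h1 := hval t ht
  have h2 := hval t' ht'
  have h3 := Nat.div_add_mod ((t : ℕ) + c) h
  have h4 := Nat.div_add_mod ((t' : ℕ) + c) h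
  simp only at heq
  rw [h1, heq] at h3
  rw [h2] at h4
  exact Fin.ext (by omega)

/-- Averaged over the offset, the boundary layers carry a `1 / h` fraction of the cumulative
memory. -/
theorem sum_logb_boundaryStates_le {N : ℕ} [NeZero N] (P : BranchingProgram (Fin N) n) (h : ℕ) :
    ∑ c ∈ Finset.range h, Real.logb 2 (P.boundaryStates (segment P.time h c))
      ≤ P.cumulativeMemory := by
  have hw : ∀ t, 0 ≤ Real.logb 2 (P.width t) := fun t =>
    Real.logb_nonneg (by norm_num) (by exact_mod_cast P.one_le_width t)
  have hlog : ∀ c, Real.logb 2 (P.boundaryStates (segment P.time h c)) =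
      ∑ t : Fin P.time, if segment P.time h c (t + 1) ≠ segment P.time h c t
        then Real.logb 2 (P.width t.succ) else 0 := by
    intro c
    rw [boundaryStates, Nat.cast_prod, Real.logb_prod, Finset.sum_filter]
    intro t _
    have := P.one_le_width t.succ
    exact_mod_cast (by omega : P.width t.succ ≠ 0)
  simp only [hlog]
  rw [Finset.sum_comm, cumulativeMemory, Fin.sum_univ_succ]
  refine le_add_of_nonneg_of_le (hw 0) (Finset.sum_le_sum fun t _ => ?_)
  rw [← Finset.sum_filter, Finset.sum_const, nsmul_eq_mul]
  refine mul_le_of_le_one_left (hw _) ?_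
  -- Boundaries occur only where `h ∣ t + 1 + c`, which determines `c` below `h`.
  have hcard : ((Finset.range h).filter fun c =>
      segment P.time h c (t + 1) ≠ segment P.time h c t).card ≤ 1 := by
    rw [Finset.card_le_one]
    intro c hc c' hc'
    obtain ⟨h1, h2⟩ := Finset.mem_filter.1 hc
    obtain ⟨h1', h2'⟩ := Finset.mem_filter.1 hc'
    rw [Finset.mem_range] at h1 h1'
    have hmod : (t + 1 + c) ≡ (t + 1 + c') [MOD h] :=
      ((Nat.modEq_zero_iff_dvd.2 (dvd_of_segment_ne h2)).trans
        (Nat.modEq_zero_iff_dvd.2 (dvd_of_segment_ne h2')).symm)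
    have := Nat.ModEq.add_left_cancel' _ hmod
    exact Nat.ModEq.eq_of_lt_of_lt this h1 h1'
  exact_mod_cast hcard

theorem le_time (hn : 2 ≤ n) (P : BranchingProgram (Fin (n ^ 2)) n)
    (hP : P.Computes (elementDistinctness n (n ^ 2))) : n ≤ P.time := by
  have hx : Function.Injective (Fin.castLE (by nlinarith : n ≤ n ^ 2)) := Fin.castLE_injective _
  have hs : Function.Surjective (P.queryAt (Fin.castLE (by nlinarith : n ≤ n ^ 2))) :=
    P.exists_queryAt_eq hn hP hx
  simpa using Fintype.card_le_of_surjective _ hs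

theorem le_cumulativeMemory (hn : 2 ≤ n) (P : BranchingProgram (Fin (n ^ 2)) n)
    (hP : P.Computes (elementDistinctness n (n ^ 2))) {k κ : ℕ} (hk : 2 ≤ k)
    (hκ : 1 ≤ κ) (hkκ : k ≤ 2 ^ κ) (htime : P.time ≤ k * n) {μ : ℝ}
    (hμ : μ = (n : ℝ) / ((2 : ℝ) ^ (32 * κ)) ^ (10 * k ^ 2)) (hμk : 64 * k ≤ μ)
    (hbig : 64 * (k : ℝ) ^ 2 * n ^ 2 ≤ 2 ^ (μ / 8)) :
    (n : ℝ) ^ 2 / ((2 : ℝ) ^ (32 * κ)) ^ (21 * k ^ 2) ≤ P.cumulativeMemory := by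
  have : NeZero (n ^ 2) := ⟨by positivity⟩
  have hk0 : (0 : ℝ) < k := by exact_mod_cast (by omega : 0 < k)
  -- The longest segment length allowed by the Chebyshev requirement `64 k h ≤ μ`.
  set h := ⌊μ / (64 * k)⌋₊ with hh
  have hone : 1 ≤ μ / (64 * k) := by rw [le_div_iff₀ (by positivity)]; linarith
  have hh1 : 0 < h := Nat.floor_pos.2 hone
  have hle : (h : ℝ) ≤ μ / (64 * k) := Nat.floor_le (by linarith)
  have hge : μ / (128 * k) ≤ h := by
    have h1 := Nat.lt_floor_add_one (μ / (64 * k))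
    rw [← hh] at h1
    have h2 : (1 : ℝ) ≤ h := by exact_mod_cast hh1
    have h3 : μ / (128 * k) = μ / (64 * k) / 2 := by rw [div_div]; congr 1; ring
    rw [h3]
    linarith
  have hb : ∀ c ∈ Finset.range h,
      μ / 4 ≤ Real.logb 2 (P.boundaryStates (segment P.time h c)) := by
    intro c hc
    have h1 := P.two_rpow_le_boundaryStates hn hP (segment P.time h c) hk hκ hkκ htime
      (card_segment_le hh1 (Finset.mem_range.1 hc)) hμ (by
        rw [le_div_iff₀ (by positivity)] at hle; linarith) hbig
    rw [Real.le_logb_iff_rpow_le (by norm_num) (lt_of_lt_of_le (by positivity) h1)]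
    exact h1
  have hsum := (Finset.sum_le_sum hb).trans (P.sum_logb_boundaryStates_le h)
  rw [Finset.sum_const, Finset.card_range, nsmul_eq_mul] at hsum
  refine le_trans ?_ hsum
  have hμ0 : 0 ≤ μ := by rw [hμ]; positivity
  refine le_trans ?_ (mul_le_mul_of_nonneg_right hge (by positivity))
  set q : ℝ := (2 : ℝ) ^ (32 * κ) with hq
  have hq1 : 1 ≤ q := one_le_pow₀ (by norm_num)
  -- The sum over offsets is at least `μ² / (512 k)`; absorbing `512 k` turns the exponent `20 k²`
  -- into `21 k²`.
  have hkq : 512 * (k : ℝ) ≤ q ^ (k ^ 2) := by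
    have h1 : 512 * k ≤ 2 ^ (32 * κ) := by
      calc 512 * k ≤ 2 ^ 9 * 2 ^ κ := Nat.mul_le_mul (by norm_num) hkκ
        _ = 2 ^ (9 + κ) := (pow_add _ _ _).symm
        _ ≤ _ := Nat.pow_le_pow_right (by norm_num) (by omega)
    have h2 : 512 * (k : ℝ) ≤ q := by rw [hq]; exact_mod_cast h1
    exact h2.trans (le_self_pow₀ hq1 (by positivity))
  have e : μ / (128 * k) * (μ / 4) = (n : ℝ) ^ 2 / (512 * k * (q ^ (10 * k ^ 2)) ^ 2) := by
    rw [hμ]; field_simp; norm_num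
  rw [e]
  refine div_le_div_of_nonneg_left (by positivity) (by positivity) ?_
  calc 512 * (k : ℝ) * (q ^ (10 * k ^ 2)) ^ 2 ≤ q ^ (k ^ 2) * (q ^ (10 * k ^ 2)) ^ 2 := by gcongr
    _ = q ^ (21 * k ^ 2) := by ring

/-- The bound of the main theorem, when it is at least `n ^ (7 / 4)` and `n` is large. -/
theorem edBound_le_cumulativeMemory (hn : 2 ≤ n) (P : BranchingProgram (Fin (n ^ 2)) n)
    (hP : P.Computes (elementDistinctness n (n ^ 2)))
    (hsmall : (max ((P.time : ℝ) / n) 2) ^ ((8064 : ℝ) * ((P.time : ℝ) ^ 2 / (n : ℝ) ^ 2))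
      ≤ (n : ℝ) ^ (1 / 4 : ℝ))
    (hlarge : 64 * (n : ℝ) ^ 3 ≤ 2 ^ (Real.sqrt n / 8)) :
    edBound 8064 n P.time ≤ P.cumulativeMemory := by
  have hn1 : (1 : ℝ) ≤ n := by exact_mod_cast (by omega : 1 ≤ n)
  have hn0 : (0 : ℝ) < n := by linarith
  have hτ : (1 : ℝ) ≤ (P.time : ℝ) / n := by
    rw [le_div_iff₀ hn0, one_mul]; exact_mod_cast P.le_time hn hP
  set ρ : ℝ := (P.time : ℝ) / n with hρ
  set M : ℝ := max ρ 2 with hM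
  have hM2 : 2 ≤ M := le_max_right _ _
  have hρM : ρ ≤ M := le_max_left _ _
  set k : ℕ := max 2 ⌈ρ⌉₊ with hk
  have hk2 : 2 ≤ k := le_max_left _ _
  have hρk : ρ ≤ k := (Nat.le_ceil ρ).trans (by exact_mod_cast le_max_right _ _)
  have hkρ : (k : ℝ) ≤ 2 * ρ := by
    rw [hk, Nat.cast_max]
    refine max_le (by push_cast; linarith) ?_
    have := Nat.ceil_lt_add_one (show 0 ≤ ρ by linarith)
    linarith
  set κ : ℕ := Nat.clog 2 k with hκ
  have hκ1 : 1 ≤ κ := Nat.clog_pos (by norm_num) hk2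
  have hkκ : k ≤ 2 ^ κ := Nat.le_pow_clog (by norm_num) k
  -- `2 ^ κ ≤ 2 k ≤ 4 M ≤ M ^ 3`, since `M ≥ 2`.
  have hκM : (2 : ℝ) ^ κ ≤ M ^ 3 := by
    have h1 : 2 ^ (κ - 1) < k := Nat.pow_pred_clog_lt_self (by norm_num) (by omega)
    have h2 : (2 : ℝ) ^ (κ - 1) ≤ k := by exact_mod_cast h1.le
    have h3 : (2 : ℝ) ^ κ = 2 ^ (κ - 1) * 2 := by
      rw [← pow_succ]; congr 1; omega
    rw [h3]
    nlinarith [mul_nonneg (show 0 ≤ M by linarith) (show 0 ≤ M - 2 by linarith)]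
  set q : ℝ := (2 : ℝ) ^ (32 * κ) with hq
  have hq1 : 1 ≤ q := one_le_pow₀ (by norm_num)
  -- Origin of the constant: `8064 = 32 * 21 * 3 * 4`, the `3` from `2 ^ κ ≤ M ^ 3` and the `4` from
  -- `k ≤ 2 ρ`.
  have hqM : q ^ (21 * k ^ 2) ≤ M ^ ((8064 : ℝ) * ((P.time : ℝ) ^ 2 / (n : ℝ) ^ 2)) := by
    have e1 : q ^ (21 * k ^ 2) = ((2 : ℝ) ^ κ) ^ (672 * k ^ 2) := by
      rw [hq, ← pow_mul, ← pow_mul]; congr 1; ring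
    have e2 : (P.time : ℝ) ^ 2 / (n : ℝ) ^ 2 = ρ ^ 2 := by rw [hρ, div_pow]
    rw [e1, e2]
    calc ((2 : ℝ) ^ κ) ^ (672 * k ^ 2) ≤ (M ^ 3) ^ (672 * k ^ 2) := by gcongr
      _ = M ^ (((2016 * k ^ 2 : ℕ) : ℝ)) := by
          rw [Real.rpow_natCast, ← pow_mul]; congr 1; ring
      _ ≤ _ := by
          refine Real.rpow_le_rpow_of_exponent_le (by linarith) ?_
          push_cast
          nlinarith [show (0 : ℝ) ≤ k by positivity]
  have hqn := hqM.trans hsmall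
  have hn4 : (n : ℝ) ^ (1 / 4 : ℝ) ≤ Real.sqrt n := by
    rw [Real.sqrt_eq_rpow]
    exact Real.rpow_le_rpow_of_exponent_le hn1 (by norm_num)
  have hsq := Real.mul_self_sqrt hn0.le
  have hs0 : 0 < Real.sqrt n := Real.sqrt_pos.2 hn0
  have hqs : q ^ (21 * k ^ 2) ≤ Real.sqrt n := hqn.trans hn4
  have hkq : 64 * (k : ℝ) ≤ q ^ (11 * k ^ 2) := by
    have h1 : 64 * k ≤ 2 ^ (32 * κ) := by
      calc 64 * k ≤ 2 ^ 6 * 2 ^ κ := Nat.mul_le_mul (by norm_num) hkκ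
        _ = 2 ^ (6 + κ) := (pow_add _ _ _).symm
        _ ≤ _ := Nat.pow_le_pow_right (by norm_num) (by omega)
    have h2 : 64 * (k : ℝ) ≤ q := by rw [hq]; exact_mod_cast h1
    exact h2.trans (le_self_pow₀ hq1 (by positivity))
  have hq10 : q ^ (10 * k ^ 2) ≤ Real.sqrt n :=
    (pow_le_pow_right₀ hq1 (by nlinarith)).trans hqs
  have hk_sqrt : 64 * (k : ℝ) ≤ Real.sqrt n :=
    hkq.trans ((pow_le_pow_right₀ hq1 (by nlinarith)).trans hqs)
  have hμs : Real.sqrt n ≤ (n : ℝ) / q ^ (10 * k ^ 2) := by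
    rw [le_div_iff₀ (by positivity)]
    nlinarith
  have hcm := P.le_cumulativeMemory hn hP hk2 hκ1 hkκ (by
      have : (P.time : ℝ) ≤ k * n := by rw [← div_le_iff₀ hn0]; exact hρk
      exact_mod_cast this) rfl (hk_sqrt.trans hμs) (by
      have h1 : 64 * (k : ℝ) ^ 2 * n ^ 2 ≤ 64 * n ^ 3 := by
        have : (k : ℝ) ^ 2 ≤ n := by
          have : (k : ℝ) ≤ Real.sqrt n := by linarith [show (0 : ℝ) ≤ k by positivity]
          nlinarith [show (0 : ℝ) ≤ k by positivity]
        nlinarith [sq_nonneg (n : ℝ)]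
      refine (h1.trans hlarge).trans ?_
      refine Real.rpow_le_rpow_of_exponent_le (by norm_num) ?_
      linarith)
  refine le_trans ?_ hcm
  unfold edBound
  refine div_le_div_of_nonneg_left (by positivity) (by positivity) hqM

end BranchingProgram

/-! ### Asymptotics. -/

open Filter Topology in
theorem eventually_cube_le_two_rpow_sqrt :
    ∀ᶠ n : ℕ in atTop, 64 * (n : ℝ) ^ 3 ≤ 2 ^ (Real.sqrt n / 8) := by
  have h1 : Tendsto (fun y : ℝ => Real.exp ((Real.log 2 / 8) * y) / y ^ (6 : ℝ)) atTop atTop :=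
    tendsto_exp_mul_div_rpow_atTop 6 _ (by positivity)
  have h2 : Tendsto (fun n : ℕ => Real.sqrt n) atTop atTop :=
    Real.tendsto_sqrt_atTop.comp tendsto_natCast_atTop_atTop
  filter_upwards [(h1.comp h2).eventually_ge_atTop 64, eventually_gt_atTop 0] with n hn hn0
  have hs : 0 < Real.sqrt n := Real.sqrt_pos.2 (by exact_mod_cast hn0)
  simp only [Function.comp_apply] at hn
  rw [le_div_iff₀ (by positivity)] at hn
  have e1 : Real.sqrt n ^ (6 : ℝ) = (n : ℝ) ^ 3 := by
    rw [show (6 : ℝ) = ((6 : ℕ) : ℝ) by norm_num, Real.rpow_natCast,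
      show (6 : ℕ) = 2 * 3 by norm_num, pow_mul, Real.sq_sqrt (by positivity)]
  rw [e1] at hn
  rw [Real.rpow_def_of_pos (by norm_num)]
  refine hn.trans (le_of_eq ?_)
  congr 1
  ring

open Filter Topology in
/-- The exponent that the time bound `T` costs tends to `0`. -/
theorem tendsto_exponent_zero {T : ℕ → ℕ} (C : ℝ) (hC : 0 ≤ C)
    (hT : Asymptotics.IsLittleO atTop (fun n : ℕ => (T n : ℝ))
      (fun n : ℕ => (n : ℝ) * Real.sqrt (Real.log n / Real.log (Real.log n)))) :
    Tendsto (fun n : ℕ => C * ((T n : ℝ) ^ 2 / (n : ℝ) ^ 2)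
      * Real.log (max ((T n : ℝ) / n) 2) / Real.log n) atTop (𝓝 0) := by
  have hε := hT.tendsto_div_nhds_zero
  have hlog : Tendsto (fun n : ℕ => Real.log n) atTop atTop :=
    Real.tendsto_log_atTop.comp tendsto_natCast_atTop_atTop
  have hloglog : Tendsto (fun n : ℕ => Real.log (Real.log n)) atTop atTop :=
    Real.tendsto_log_atTop.comp hlog
  have hup : Tendsto (fun n : ℕ => C * ((T n : ℝ) /
      ((n : ℝ) * Real.sqrt (Real.log n / Real.log (Real.log n)))) ^ 2) atTop (𝓝 0) := by
    simpa using (hε.pow 2).const_mul C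
  refine tendsto_of_tendsto_of_tendsto_of_le_of_le' tendsto_const_nhds hup ?_ ?_
  · filter_upwards [hlog.eventually_ge_atTop 0] with n hn
    have : 0 ≤ Real.log (max ((T n : ℝ) / n) 2) :=
      Real.log_nonneg (le_trans (by norm_num) (le_max_right _ _))
    positivity
  · filter_upwards [hlog.eventually_ge_atTop 2, hloglog.eventually_ge_atTop 1,
      hε.eventually_le_const (zero_lt_one), eventually_gt_atTop 0] with n hL hLL hle hn
    have hn0 : (0 : ℝ) < n := by exact_mod_cast hn
    set L := Real.log n with hLdef
    set LL := Real.log L with hLLdef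
    have hs : 0 < Real.sqrt (L / LL) := Real.sqrt_pos.2 (by positivity)
    have hss : Real.sqrt (L / LL) ^ 2 = L / LL := Real.sq_sqrt (by positivity)
    rw [div_le_one (by positivity)] at hle
    -- A crude bound suffices: `T n / n ≤ L` already gives a logarithm of at most `LL`, which
    -- cancels the `log log n` of the hypothesis.
    have hsL : Real.sqrt (L / LL) ≤ L := by
      have : L / LL ≤ L ^ 2 := by
        rw [div_le_iff₀ (by linarith)]
        nlinarith [mul_nonneg (sq_nonneg L) (show 0 ≤ LL - 1 by linarith)]
      rw [Real.sqrt_le_left (by linarith)]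
      exact this
    have hM : max ((T n : ℝ) / n) 2 ≤ L := by
      refine max_le ?_ hL
      rw [div_le_iff₀ hn0]
      nlinarith
    have hlogM : Real.log (max ((T n : ℝ) / n) 2) ≤ LL :=
      Real.log_le_log (lt_of_lt_of_le (by norm_num) (le_max_right _ _)) hM
    rw [div_pow, mul_pow, hss, div_le_iff₀ (by linarith)]
    calc C * ((T n : ℝ) ^ 2 / (n : ℝ) ^ 2) * Real.log (max ((T n : ℝ) / n) 2)
        ≤ C * ((T n : ℝ) ^ 2 / (n : ℝ) ^ 2) * LL := by gcongr
      _ = C * ((T n : ℝ) ^ 2 / ((n : ℝ) ^ 2 * (L / LL))) * L := by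
          field_simp

theorem mainTheorem10 :
    ∃ C : ℝ, 0 < C ∧ ∀ T : ℕ → ℕ,
      Asymptotics.IsLittleO Filter.atTop (fun n : ℕ => (T n : ℝ))
        (fun n : ℕ => (n : ℝ) * Real.sqrt (Real.log n / Real.log (Real.log n))) →
      ∃ δ : ℕ → ℝ, Filter.Tendsto δ Filter.atTop (nhds 0) ∧
        ∀ᶠ n : ℕ in Filter.atTop, ∀ P : BranchingProgram (Fin (n ^ 2)) n,
          P.time ≤ T n → P.Computes (elementDistinctness n (n ^ 2)) →
            edBound C n P.time ≤ P.cumulativeMemory ∧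
            (n : ℝ) ^ (2 - δ n) ≤ edBound C n P.time := by
  -- The witness for `δ n` is the logarithm to base `n` of the loss at time `T n`. The loss is
  -- monotone in time, so `n ^ δ n` bounds it for every `τ ≤ T n`; eventually `δ n ≤ 1 / 4`.
  refine ⟨8064, by norm_num, fun T hT => ⟨_, tendsto_exponent_zero 8064 (by norm_num) hT, ?_⟩⟩
  filter_upwards [(tendsto_exponent_zero 8064 (by norm_num) hT).eventually_le_const
    (show (0 : ℝ) < 1 / 4 by norm_num), eventually_cube_le_two_rpow_sqrt,
    Filter.eventually_ge_atTop 2] with n hδ hlarge hn P htime hP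
  have hn1 : (1 : ℝ) < n := by exact_mod_cast (by omega : 1 < n)
  have hn0 : (0 : ℝ) < n := by linarith
  set δ : ℝ := 8064 * ((T n : ℝ) ^ 2 / (n : ℝ) ^ 2) * Real.log (max ((T n : ℝ) / n) 2)
    / Real.log n with hδdef
  have hT' : (P.time : ℝ) ≤ T n := by exact_mod_cast htime
  have hM : (2 : ℝ) ≤ max ((P.time : ℝ) / n) 2 := le_max_right _ _
  have hpow : (max ((P.time : ℝ) / n) 2) ^ ((8064 : ℝ) * ((P.time : ℝ) ^ 2 / (n : ℝ) ^ 2))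
      ≤ (n : ℝ) ^ δ := by
    calc (max ((P.time : ℝ) / n) 2) ^ ((8064 : ℝ) * ((P.time : ℝ) ^ 2 / (n : ℝ) ^ 2))
        ≤ (max ((T n : ℝ) / n) 2) ^ ((8064 : ℝ) * ((P.time : ℝ) ^ 2 / (n : ℝ) ^ 2)) := by
          refine Real.rpow_le_rpow (by linarith) ?_ (by positivity)
          gcongr
      _ ≤ (max ((T n : ℝ) / n) 2) ^ ((8064 : ℝ) * ((T n : ℝ) ^ 2 / (n : ℝ) ^ 2)) := by
          refine Real.rpow_le_rpow_of_exponent_le (le_trans (by norm_num) (le_max_right _ _)) ?_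
          gcongr
      _ = (n : ℝ) ^ δ := by
          rw [Real.rpow_def_of_pos (lt_of_lt_of_le (by norm_num) (le_max_right _ _)),
            Real.rpow_def_of_pos hn0, hδdef, mul_div_cancel₀ _ (Real.log_pos hn1).ne', mul_comm]
  constructor
  · exact P.edBound_le_cumulativeMemory hn hP
      (hpow.trans (Real.rpow_le_rpow_of_exponent_le hn1.le hδ)) hlarge
  · unfold edBound
    rw [Real.rpow_sub hn0, Real.rpow_two]
    exact div_le_div_of_nonneg_left (by positivity)
      (Real.rpow_pos_of_pos (by linarith) _) hpow
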